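/- **Setting.** Fix $p>1$ and a branching function $\mathbf b:\mathbb Z\to\mathbb N$ with $2\le\inf_{\mathbb Z}\mathbf b\le\sup_{\mathbb Z}\mathbf b<\infty$. For $r>0$ let $n\in\mathbb Z$ satisfy $2^{n-1}\le r<2^n$, and put $V_{\mathbf b}(r)=\big(\prod_{k=n}^{0}\mathbf b(k)\big)^{-1}$ if $n\le 0$ and $V_{\mathbf b}(r)=\prod_{k=1}^{n-1}\mathbf b(k)$ if $n\ge1$. *The tree.* Let $\mathcal U(\mathbf b)$ be the set of all $\mathbf s:\mathbb Z\to\mathbb Z$ with $\mathbf s(k)\in\{0,\dots,\mathbf b(k)-1\}$ for all $k$ and $\mathbf s(k)=0$ for all large $k$. The $\mathbb R$-tree $\mathcal T(\mathbf b)$ is built from cells. For $n\in\mathbb Z$, an $n$-cell has diameter $2^n$, one center, and $\mathbf b(n)$ tips at distance $2^{n-1}$ from the center, one in each of its $\mathbf b(n)$ branches. Fix distinct labels $i_k,o_k\in\{0,\dots,\mathbf b(k)-1\}$ for every $k\in\mathbb Z$. An $n$-cell is obtained by gluing $\mathbf b(n)$ copies (the branches $0,\dots,\mathbf b(n)-1$)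 of an $(n-1)$-cell at their tips number $i_{n-1}$; the common point is the center of the $n$-cell, and the tip number $o_{n-1}$ of the $j$-th copy is the $j$-th tip of the $n$-cell. Explicitly, the distance in an $m$-cell from the point with address $\mathbf s\in\mathcal U(\mathbf b)$ to the $i$-th tip is $$D_m(\mathbf s,i)=\sum_{k\le m}2^{k-1}\mathbf 1_{\{\mathbf s(k)\ne a_k\}},\qquad a_m=i,\quad a_{k-1}=\begin{cases}o_{k-1}&\text{if }\mathbf s(k)=a_k,\\ i_{k-1}&\text{if }\mathbf s(k)\neq a_k,\end{cases}$$ and for $\mathbf s\ne\mathbf t$ with $n=\max\{k:\mathbf s(k)\ne\mathbf t(k)\}$ one puts $\mathbf d(\mathbf s,\mathbf t)=D_{n-1}(\mathbf s,i_{n-1})+D_{n-1}(\mathbf t,i_{n-1})$, and $\mathbf d(\mathbf s,\mathbf s)=0$. Then $\mathcal T=\mathcal T(\mathbf b)$ is the metric space obtained from the pseudometric space $(\mathcal U(\mathbf b),\mathbf d)$ by identifying points at distance $0$, with projection $\chi:\mathcal U(\mathbf b)\to\mathcal T$. The measure $\mathbf m$ on $\mathcal T$ is the pushforward under $\chi$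 of the measure on $\mathcal U(\mathbf b)$ for which each set $\{\mathbf t:\mathbf t(k)=\mathbf s(k)\text{ for all }k>n\}$ has measure $V_{\mathbf b}(2^n)$. Balls $B=B(x,r)$ are open, and $8B=B(x,8r)$. *The energy.* Let $[x,y]$ be the geodesic from $x$ to $y$, and let $c(x,y,z)$ be the point with $[x,y]\cap[x,z]=[x,c(x,y,z)]$. Let $\lambda$ be the length measure, i.e. the restriction of the one-dimensional Hausdorff measure to the skeleton $\bigcup_{x,y}[x,y]\setminus\{x,y\}$. A continuous function $f:\mathcal T\to\mathbb R$ is locally absolutely continuous if for every $\varepsilon>0$ and every Borel set $S$ with $\lambda(S)\in(0,\infty)$ there is $\delta>0$ such that $\sum_k|f(t_k)-f(s_k)|<\varepsilon$ for all finitely many disjoint geodesics $[t_k,s_k]\subseteq S$ with $\sum_k\mathbf d(t_k,s_k)<\delta$. Fix a root $\rho\in\mathcal T$. The gradient $\nabla f$ of such an $f$ is the $\lambda$-a.e. unique measurable function $g$, integrable on all geodesics with respect to $\lambda$, such that $$f(y)-f(x)=\int_{[c(\rho,x,y),y]}g\,\mathrm d\lambda-\int_{[c(\rho,x,y),x]}g\,\mathrm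 d\lambda\qquad\text{for all }x,y\in\mathcal T .$$ Put $\mathcal E(f)=\int_{\mathcal T}|\nabla f|^p\,\mathrm d\lambda$, and let $\mathcal F$ be the set of all locally absolutely continuous $f\in L^p(\mathcal T;\mathbf m)$ with $\mathcal E(f)<\infty$. For Borel sets $A_1,A_2$ let $\mathrm{cap}(A_1,A_2)$ be the infimum of $\mathcal E(\varphi)$ over all $\varphi\in\mathcal F$ with $\varphi=1$ in an open neighborhood of $A_1$ and $\varphi=0$ in an open neighborhood of $A_2$. **Proposition.** There exist $C_1,C_2,C_3,C_4>0$ such that for any ball $B$ in $\mathcal T(\mathbf b)$ with radius $r>0$ there exists $\phi\in\mathcal F\cap C_c(\mathcal T)$ with $0\le\phi\le1$ in $\mathcal T$, $\phi=1$ in $B$, $\phi=0$ on $\mathcal T\setminus(8B)$, such that $$\mathcal E(\phi)\le\frac{C_1}{r^{p-1}},\qquad \mathrm{cap}\big(B,\mathcal T\setminus(8B)\big)\le\frac{C_1}{r^{p-1}}\le C_2\frac{\mathbf m(B)}{r^{p-1}V_{\mathbf b}(r)},$$ and such that for any $f\in\mathcal F$ $$\int_{8B}|f|^p|\nabla\phi|^p\,\mathrm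 d\lambda\le C_3\int_{8B}|\nabla f|^p\,\mathrm d\lambda+\frac{C_4}{r^{p-1}V_{\mathbf b}(r)}\int_{8B}|f|^p\,\mathrm d\mathbf m .$$ -/

import Mathlib

open MeasureTheory Set Filter Topology
open scoped ENNReal NNReal

noncomputable section

/-! ## The real tree of a branching function -/

/-- A branching function `b : ℤ → ℕ` with `2 ≤ inf b ≤ sup b < ∞`. -/
structure BranchingFunction where
  toFun : ℤ → ℕ
  two_le : ∀ k, 2 ≤ toFun k
  bddAbove : BddAbove (Set.range toFun)

instance : CoeFun BranchingFunction (fun _ => ℤ → ℕ) := ⟨BranchingFunction.toFun⟩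

instance BranchingFunction.neZero (b : BranchingFunction) (k : ℤ) : NeZero (b k) :=
  ⟨by have := b.two_le k; omega⟩

/-- The volume function: for `2 ^ (n - 1) ≤ r < 2 ^ n` it equals
`(∏_{k = n}^{0} b k)⁻¹` if `n ≤ 0`, and `∏_{k = 1}^{n - 1} b k` if `n ≥ 1`
(so it is `1` if `n = 1`).  Here `n = Int.log 2 r + 1`, for `r > 0`. -/
def BranchingFunction.vol (b : BranchingFunction) (r : ℝ) : ℝ :=
  let n : ℤ := Int.log 2 r + 1
  if n ≤ 0 then (∏ k ∈ Finset.Icc n 0, (b k : ℝ))⁻¹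
  else ∏ k ∈ Finset.Icc 1 (n - 1), (b k : ℝ)

/-- The ultrametric space `𝒰(b)`: sequences `s : ℤ → {0, 1, …}` with `s k < b k` for all `k` and
`s k → 0`, that is, `s k = 0` for all large `k`. -/
@[ext] structure Address (b : BranchingFunction) where
  digit : ℤ → ℕ
  digit_lt : ∀ k, digit k < b k
  eventually_zero : ∀ᶠ k in atTop, digit k = 0

instance (b : BranchingFunction) : CoeFun (Address b) (fun _ => ℤ → ℕ) := ⟨Address.digit⟩

/-- The choice, for each level `k`, of the vertices at which copies of the `k`-cell are glued.

The `k`-cell has `b k` tips, one in each of its branches `0, …, b k - 1`.  A `(k + 1)`-cell consists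
of `b (k + 1)` copies of the `k`-cell, glued together at their tips number `inner k`; the common
point is the center of the `(k + 1)`-cell.  The tip number `outer k` of the `i`-th copy is the
`i`-th tip of the `(k + 1)`-cell. -/
structure GluingLabels (b : BranchingFunction) where
  inner : ℤ → ℕ
  outer : ℤ → ℕ
  inner_lt : ∀ k, inner k < b k
  outer_lt : ∀ k, outer k < b k
  inner_ne_outer : ∀ k, inner k ≠ outer k

namespace GluingLabels

variable {b : BranchingFunction} (L : GluingLabels b)

/-- When one walks inside an `m`-cell, from the point with address `s` to the tip number `i` of
the `m`-cell, `tipIndex L m i s j` is the number of the tip of the `(m - j)`-cell of `s`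
through which one leaves this `(m - j)`-cell: if the `(m - j - 1)`-cell of `s` lies in the branch
of that tip, it is left through its outer tip, and otherwise through its inner tip. -/
def tipIndex (m : ℤ) (i : ℕ) (s : Address b) : ℕ → ℕ
  | 0 => i
  | j + 1 => if s (m - j) = tipIndex m i s j then L.outer (m - j - 1) else L.inner (m - j - 1)

/-- The distance, inside an `m`-cell (of diameter `2 ^ m`), between the point with address `s` and
the tip number `i` of the `m`-cell.  Equivalently (see `tipDist_eq`), it is the distance of `s` to
the outer tip of its `(m - 1)`-cell if this is the `i`-th branch of the `m`-cell, and otherwise it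
is the distance of `s` to the center of the `m`-cell plus `2 ^ (m - 1)`. -/
def tipDist (m : ℤ) (i : ℕ) (s : Address b) : ℝ :=
  ∑' j : ℕ, if s (m - j) = L.tipIndex m i s j then 0 else (2 : ℝ) ^ (m - j - 1)

/-- The largest `k` with `s k ≠ t k`, for `s ≠ t`. -/
def topLevel (s t : Address b) : ℤ := sSup {k : ℤ | s k ≠ t k}

open Classical in
/-- The distance of the points of the tree with addresses `s` and `t`.  If `s ≠ t` first
differ (from above) at level `n`, then these points lie in distinct copies of the `(n - 1)`-cell
in a common `n`-cell, and the distance is the sum of the distances to the center of that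
`n`-cell, that is, to the inner tips of these copies. -/
def treeDist (s t : Address b) : ℝ :=
  if s = t then 0
  else L.tipDist (topLevel s t - 1) (L.inner (topLevel s t - 1)) s
    + L.tipDist (topLevel s t - 1) (L.inner (topLevel s t - 1)) t

theorem tipTerm_le (m : ℤ) (i : ℕ) (s : Address b) (j : ℕ) :
    (if s (m - j) = L.tipIndex m i s j then 0 else (2 : ℝ) ^ (m - j - 1))
      ≤ (2 : ℝ) ^ (m - 1) * (1 / 2) ^ j := by
  have h : (2 : ℝ) ^ (m - j - 1) = (2 : ℝ) ^ (m - 1) * (1 / 2) ^ j := by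
    rw [show m - (j : ℤ) - 1 = (m - 1) - j by ring, zpow_sub₀ (by norm_num), zpow_natCast]
    rw [one_div, inv_pow, div_eq_mul_inv]
  split_ifs
  · positivity
  · exact h.le

theorem tipTerm_nonneg (m : ℤ) (i : ℕ) (s : Address b) (j : ℕ) :
    0 ≤ (if s (m - j) = L.tipIndex m i s j then 0 else (2 : ℝ) ^ (m - j - 1)) := by
  split_ifs <;> positivity

theorem summable_tipTerm (m : ℤ) (i : ℕ) (s : Address b) :
    Summable fun j : ℕ =>
      if s (m - j) = L.tipIndex m i s j then 0 else (2 : ℝ) ^ (m - j - 1) :=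
  Summable.of_nonneg_of_le (L.tipTerm_nonneg m i s) (L.tipTerm_le m i s)
    ((summable_geometric_of_lt_one (by norm_num) (by norm_num)).mul_left _)

theorem tipDist_nonneg (m : ℤ) (i : ℕ) (s : Address b) : 0 ≤ L.tipDist m i s :=
  tsum_nonneg (L.tipTerm_nonneg m i s)

theorem tipDist_le (m : ℤ) (i : ℕ) (s : Address b) : L.tipDist m i s ≤ (2 : ℝ) ^ m := by
  refine ((L.summable_tipTerm m i s).tsum_le_tsum (L.tipTerm_le m i s)
    ((summable_geometric_of_lt_one (by norm_num) (by norm_num)).mul_left _)).trans ?_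
  rw [tsum_mul_left, tsum_geometric_of_lt_one (by norm_num) (by norm_num),
    zpow_sub_one₀ (by norm_num)]
  apply le_of_eq
  ring

theorem tipIndex_succ (m : ℤ) (i : ℕ) (s : Address b) (j : ℕ) :
    L.tipIndex m i s (j + 1) =
      L.tipIndex (m - 1) (if s m = i then L.outer (m - 1) else L.inner (m - 1)) s j := by
  induction j with
  | zero => simp [tipIndex]
  | succ j ih =>
    rw [tipIndex, ih]
    conv_rhs => rw [tipIndex]
    rw [show m - ((j + 1 : ℕ) : ℤ) = m - 1 - j by push_cast; ring]

theorem tipDist_eq (m : ℤ) (i : ℕ) (s : Address b) :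
    L.tipDist m i s = if s m = i then L.tipDist (m - 1) (L.outer (m - 1)) s
      else L.tipDist (m - 1) (L.inner (m - 1)) s + (2 : ℝ) ^ (m - 1) := by
  rw [tipDist, (L.summable_tipTerm m i s).tsum_eq_zero_add]
  have h : ∀ j : ℕ, (if s (m - (j + 1 : ℕ)) = L.tipIndex m i s (j + 1) then (0 : ℝ)
      else (2 : ℝ) ^ (m - (j + 1 : ℕ) - 1)) =
      if s (m - 1 - j) = L.tipIndex (m - 1)
        (if s m = i then L.outer (m - 1) else L.inner (m - 1)) s j then (0 : ℝ)
      else (2 : ℝ) ^ (m - 1 - j - 1) := by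
    intro j
    rw [tipIndex_succ, show m - ((j + 1 : ℕ) : ℤ) = m - 1 - j by push_cast; ring]
  simp_rw [h]
  by_cases hi : s m = i
  · simp [hi, tipIndex, tipDist]
  · simp [hi, tipIndex, tipDist, add_comm]

/-- Two distinct tips of an `m`-cell have distance at least `2 ^ m`. -/
theorem le_tipDist_add_tipDist (m : ℤ) {i i' : ℕ} (h : i ≠ i') (s : Address b) :
    (2 : ℝ) ^ m ≤ L.tipDist m i s + L.tipDist m i' s := by
  have key : ∀ (n : ℕ) (m : ℤ) (i i' : ℕ), i ≠ i' →
      (2 : ℝ) ^ m ≤ L.tipDist m i s + L.tipDist m i' s + (2 : ℝ) ^ m * (1 / 2) ^ n := by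
    intro n
    induction n with
    | zero =>
      intro m i i' _
      have := L.tipDist_nonneg m i s
      have := L.tipDist_nonneg m i' s
      simp only [pow_zero, mul_one]
      linarith
    | succ n ih =>
      intro m i i' hii
      have h2 : (2 : ℝ) ^ m = 2 * (2 : ℝ) ^ (m - 1) := by
        rw [zpow_sub_one₀ (by norm_num)]; ring
      have hp : (0 : ℝ) < (2 : ℝ) ^ (m - 1) * (1 / 2) ^ n := by positivity
      have hq : (2 : ℝ) ^ m * (1 / 2) ^ (n + 1) = (2 : ℝ) ^ (m - 1) * (1 / 2) ^ n := by
        rw [h2, pow_succ]; ring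
      have h3 := ih (m - 1) _ _ (L.inner_ne_outer (m - 1))
      have h4 := L.tipDist_nonneg (m - 1) (L.inner (m - 1)) s
      rw [hq, L.tipDist_eq m i, L.tipDist_eq m i']
      by_cases hi : s m = i
      · have hi' : s m ≠ i' := fun e => hii (hi.symm.trans e)
        rw [if_pos hi, if_neg hi']; linarith
      · rw [if_neg hi]
        by_cases hi' : s m = i'
        · rw [if_pos hi']; linarith
        · rw [if_neg hi']; linarith
  have hlim : Tendsto (fun n : ℕ => L.tipDist m i s + L.tipDist m i' s
      + (2 : ℝ) ^ m * (1 / 2) ^ n) atTop (𝓝 (L.tipDist m i s + L.tipDist m i' s)) := by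
    have := (tendsto_pow_atTop_nhds_zero_of_lt_one (r := (1 / 2 : ℝ)) (by norm_num)
      (by norm_num)).const_mul ((2 : ℝ) ^ m)
    simpa using this.const_add (L.tipDist m i s + L.tipDist m i' s)
  exact ge_of_tendsto' hlim fun n => key n m i i' h

theorem bddAbove_ne (s t : Address b) : BddAbove {k : ℤ | s k ≠ t k} := by
  obtain ⟨N, hN⟩ := eventually_atTop.1 (s.eventually_zero.and t.eventually_zero)
  refine ⟨N, fun k hk => ?_⟩
  by_contra hlt
  obtain ⟨h1, h2⟩ := hN k (by omega)
  exact hk (h1.trans h2.symm)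

theorem topLevel_spec {s t : Address b} (h : s ≠ t) :
    s (topLevel s t) ≠ t (topLevel s t) ∧ ∀ k, topLevel s t < k → s k = t k := by
  have hne : {k : ℤ | s k ≠ t k}.Nonempty := by
    by_contra hc
    rw [Set.not_nonempty_iff_eq_empty] at hc
    refine h (Address.ext (funext fun k => ?_))
    by_contra hk
    exact (hc ▸ (show k ∈ {k : ℤ | s k ≠ t k} from hk) : k ∈ (∅ : Set ℤ))
  refine ⟨Int.csSup_mem hne (bddAbove_ne s t), fun k hk => ?_⟩
  by_contra hc
  exact absurd (le_csSup (bddAbove_ne s t) (show k ∈ {k : ℤ | s k ≠ t k} from hc))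
    (not_le.2 hk)

theorem topLevel_comm (s t : Address b) : topLevel s t = topLevel t s := by
  simp only [topLevel, ne_comm]

theorem treeDist_comm (s t : Address b) : L.treeDist s t = L.treeDist t s := by
  unfold treeDist
  rw [topLevel_comm t s]
  by_cases h : s = t
  · rw [if_pos h, if_pos h.symm]
  · rw [if_neg h, if_neg (Ne.symm h), add_comm]

theorem treeDist_of_ne {s t : Address b} (h : s ≠ t) :
    L.treeDist s t = L.tipDist (topLevel s t - 1) (L.inner (topLevel s t - 1)) s
    + L.tipDist (topLevel s t - 1) (L.inner (topLevel s t - 1)) t := by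
  rw [treeDist, if_neg h]

theorem tipDist_le_treeDist_add {s t : Address b} (h : s ≠ t) (n : ℕ) :
    ∀ i, L.tipDist (topLevel s t + n) i s ≤
      L.treeDist s t + L.tipDist (topLevel s t + n) i t := by
  obtain ⟨h1, h2⟩ := topLevel_spec h
  rw [L.treeDist_of_ne h]
  set m := topLevel s t
  induction n with
  | zero =>
    intro i
    have hs := L.tipDist_nonneg (m - 1) (L.inner (m - 1)) s
    have ht := L.tipDist_nonneg (m - 1) (L.inner (m - 1)) t
    have hs' := L.tipDist_le (m - 1) (L.outer (m - 1)) s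
    have ht' := L.le_tipDist_add_tipDist (m - 1) (L.inner_ne_outer (m - 1)) t
    simp only [Nat.cast_zero, add_zero]
    rw [L.tipDist_eq m i s, L.tipDist_eq m i t]
    by_cases hi : s m = i
    · have hi' : t m ≠ i := fun e => h1 (hi.trans e.symm)
      rw [if_pos hi, if_neg hi']; linarith
    · rw [if_neg hi]
      by_cases hi' : t m = i
      · rw [if_pos hi']; linarith
      · rw [if_neg hi']; linarith
  | succ n ih =>
    intro i
    have e : s (m + (n + 1 : ℕ)) = t (m + (n + 1 : ℕ)) := h2 _ (by push_cast; omega)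
    rw [L.tipDist_eq _ i s, L.tipDist_eq _ i t, e,
      show m + ((n + 1 : ℕ) : ℤ) - 1 = m + n by push_cast; ring]
    have ha := ih (L.outer (m + n))
    have hb := ih (L.inner (m + n))
    split_ifs <;> linarith

theorem treeDist_le_tipDist_add {s t : Address b} (h : s ≠ t) (n : ℕ) :
    ∀ i, L.treeDist s t ≤
      L.tipDist (topLevel s t + n) i s + L.tipDist (topLevel s t + n) i t := by
  obtain ⟨h1, h2⟩ := topLevel_spec h
  rw [L.treeDist_of_ne h]
  set m := topLevel s t
  induction n with
  | zero =>
    intro i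
    have hs := L.tipDist_nonneg (m - 1) (L.outer (m - 1)) s
    have ht := L.tipDist_nonneg (m - 1) (L.outer (m - 1)) t
    have hs' := L.tipDist_le (m - 1) (L.inner (m - 1)) s
    have ht' := L.tipDist_le (m - 1) (L.inner (m - 1)) t
    have hp : (0 : ℝ) < (2 : ℝ) ^ (m - 1) := by positivity
    simp only [Nat.cast_zero, add_zero]
    rw [L.tipDist_eq m i s, L.tipDist_eq m i t]
    by_cases hi : s m = i
    · have hi' : t m ≠ i := fun e => h1 (hi.trans e.symm)
      rw [if_pos hi, if_neg hi']; linarith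
    · rw [if_neg hi]
      by_cases hi' : t m = i
      · rw [if_pos hi']; linarith
      · rw [if_neg hi']; linarith
  | succ n ih =>
    intro i
    have e : s (m + (n + 1 : ℕ)) = t (m + (n + 1 : ℕ)) := h2 _ (by push_cast; omega)
    rw [L.tipDist_eq _ i s, L.tipDist_eq _ i t, e,
      show m + ((n + 1 : ℕ) : ℤ) - 1 = m + n by push_cast; ring]
    have ha := ih (L.outer (m + n))
    have hb := ih (L.inner (m + n))
    have hp : (0 : ℝ) < (2 : ℝ) ^ (m + (n : ℤ)) := by positivity
    split_ifs <;> linarith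

theorem treeDist_nonneg (s t : Address b) : 0 ≤ L.treeDist s t := by
  unfold treeDist
  split_ifs
  · exact le_rfl
  · exact add_nonneg (L.tipDist_nonneg _ _ _) (L.tipDist_nonneg _ _ _)

theorem treeDist_triangle (s t u : Address b) :
    L.treeDist s u ≤ L.treeDist s t + L.treeDist t u := by
  by_cases hst : s = t
  · subst hst; simp [treeDist]
  by_cases htu : t = u
  · subst htu; simp [treeDist]
  by_cases hsu : s = u
  · subst hsu
    have h1 := L.treeDist_nonneg s t
    have h2 := L.treeDist_nonneg t s
    have h3 : L.treeDist s s = 0 := by simp [treeDist]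
    linarith
  obtain ⟨a1, a2⟩ := topLevel_spec hst
  obtain ⟨b1, b2⟩ := topLevel_spec htu
  obtain ⟨c1, c2⟩ := topLevel_spec hsu
  rcases lt_trichotomy (topLevel s t) (topLevel t u) with hlt | heq | hgt
  · have e : topLevel s u = topLevel t u := by
      apply le_antisymm
      · by_contra hc
        exact c1 ((a2 _ (by omega)).trans (b2 _ (by omega)))
      · by_contra hc
        exact b1 ((a2 _ hlt).symm.trans (c2 _ (by omega)))
    obtain ⟨n, hn⟩ := Int.eq_ofNat_of_zero_le (show 0 ≤ topLevel t u - 1 - topLevel s t by omega)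
    have hL := L.tipDist_le_treeDist_add hst n (L.inner (topLevel t u - 1))
    rw [show topLevel s t + (n : ℤ) = topLevel t u - 1 by omega] at hL
    rw [L.treeDist_of_ne hsu, L.treeDist_of_ne htu, e]
    linarith
  · have hle : topLevel s u ≤ topLevel t u := by
      by_contra hc
      exact c1 ((a2 _ (by omega)).trans (b2 _ (by omega)))
    rcases hle.eq_or_lt with e | hlt
    · rw [L.treeDist_of_ne hsu, L.treeDist_of_ne htu, L.treeDist_of_ne hst, e, heq]
      have := L.tipDist_nonneg (topLevel t u - 1) (L.inner (topLevel t u - 1)) t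
      linarith
    · obtain ⟨n, hn⟩ :=
        Int.eq_ofNat_of_zero_le (show 0 ≤ topLevel t u - 1 - topLevel s u by omega)
      have hL := L.treeDist_le_tipDist_add hsu n (L.inner (topLevel t u - 1))
      rw [show topLevel s u + (n : ℤ) = topLevel t u - 1 by omega] at hL
      rw [L.treeDist_of_ne hst, L.treeDist_of_ne htu, heq]
      have := L.tipDist_nonneg (topLevel t u - 1) (L.inner (topLevel t u - 1)) t
      linarith
  · have e : topLevel s u = topLevel s t := by
      apply le_antisymm
      · by_contra hc
        exact c1 ((a2 _ (by omega)).trans (b2 _ (by omega)))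
      · by_contra hc
        exact a1 ((c2 _ (by omega)).trans (b2 _ (by omega)).symm)
    obtain ⟨n, hn⟩ := Int.eq_ofNat_of_zero_le (show 0 ≤ topLevel s t - 1 - topLevel u t by
      rw [topLevel_comm u t]; omega)
    have hL := L.tipDist_le_treeDist_add (Ne.symm htu) n (L.inner (topLevel s t - 1))
    rw [show topLevel u t + (n : ℤ) = topLevel s t - 1 by omega, L.treeDist_comm u t] at hL
    rw [L.treeDist_of_ne hsu, L.treeDist_of_ne hst, e]
    linarith

/-- The addresses, with the pseudometric given by the distance of the points of the tree. -/
def PreTree (_ : GluingLabels b) : Type := Address b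

instance : PseudoMetricSpace L.PreTree where
  dist s t := L.treeDist s t
  dist_self s := if_pos rfl
  dist_comm s t := L.treeDist_comm s t
  dist_triangle s t u := L.treeDist_triangle s t u

/-- The real tree `𝒯(b)`: the metric space of addresses, where addresses at distance zero are
identified.  The `m`-cells are the images of the sets `{t | t k = s k for all k > m}`. -/
abbrev Tree : Type := SeparationQuotient L.PreTree

instance : MeasurableSpace L.Tree := borel L.Tree

instance : BorelSpace L.Tree := ⟨rfl⟩

/-- The projection `χ : 𝒰(b) → 𝒯(b)`. -/
def proj (s : Address b) : L.Tree := SeparationQuotient.mk (s : L.PreTree)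

theorem dist_proj (s t : Address b) : dist (L.proj s) (L.proj t) = L.treeDist s t := rfl

end GluingLabels

/-! ## The measure on the tree -/

/-- The σ-algebra on `𝒰(b)` generated by the digits, which is its Borel σ-algebra for the
ultrametric `2 ^ max {k | s k ≠ t k}`. -/
instance (b : BranchingFunction) : MeasurableSpace (Address b) :=
  MeasurableSpace.comap Address.digit inferInstance

/-- The address whose digits at the levels `k ≤ 0` are those of `ω`, and at the levels `k ≥ 1`
those of `τ`. -/
def Address.splice {b : BranchingFunction} (τ : Address b) (ω : ∀ k : ℤ, Fin (b k)) :
    Address b where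
  digit k := if k ≤ 0 then (ω k : ℕ) else τ k
  digit_lt k := by
    split_ifs
    · exact (ω k).isLt
    · exact τ.digit_lt k
  eventually_zero := by
    filter_upwards [τ.eventually_zero, eventually_gt_atTop 0] with k h1 h2
    rw [if_neg (by omega), h1]

/-- The measure on `𝒰(b)` whose value on each cylinder `{t | t k = s k for all k > n}`, which is
the closed ball of radius `2 ^ n` around `s`, is `V (2 ^ n)`: on each cylinder of level `0` it is
the product of the uniform probability measures of the digits `k ≤ 0`.  The cylinders of level `0`
are indexed by the addresses `τ` with `τ k = 0` for all `k ≤ 0`. -/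
def Address.measure (b : BranchingFunction) : Measure (Address b) :=
  Measure.sum fun τ : {τ : Address b // ∀ k ≤ 0, τ k = 0} =>
    (Measure.infinitePi fun k : ℤ =>
      ProbabilityTheory.uniformOn (Set.univ : Set (Fin (b k)))).map (Address.splice τ.1)

namespace Address

variable {b : BranchingFunction}

/-- The cylinder `{t | t k = s k for all k > n}`, which is the closed ball of radius `2 ^ n`
around `s` in `𝒰(b)`. -/
def cylinder (s : Address b) (n : ℤ) : Set (Address b) := {t | ∀ k, n < k → t k = s k}

theorem measurable_digit (k : ℤ) : Measurable fun s : Address b => s k :=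
  (measurable_pi_apply k).comp (comap_measurable _)

theorem measurable_splice (τ : Address b) : Measurable (splice τ) := by
  refine measurable_comap_iff.2 (measurable_pi_iff.2 fun k => ?_)
  by_cases hk : k ≤ 0
  · have : (fun ω : ∀ k : ℤ, Fin (b k) => (splice τ ω) k) = fun ω => (ω k : ℕ) := by
      funext ω; exact if_pos hk
    exact this ▸ (measurable_of_countable _).comp (measurable_pi_apply k)
  · have : (fun ω : ∀ k : ℤ, Fin (b k) => (splice τ ω) k) = fun _ => τ k := by
      funext ω; exact if_neg hk
    exact this ▸ measurable_const

theorem measurableSet_cylinder (s : Address b) (n : ℤ) : MeasurableSet (s.cylinder n) := by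
  have : s.cylinder n = ⋂ (k : ℤ) (_ : n < k), {t | t k = s k} := by
    ext t; simp [cylinder]
  rw [this]
  exact MeasurableSet.iInter fun k => MeasurableSet.iInter fun _ =>
    measurable_digit k (measurableSet_singleton _)

theorem measure_cylinder_of_nonpos (s : Address b) {n : ℤ} (hn : n ≤ 0) :
    Address.measure b (s.cylinder n) = ∏ k ∈ Finset.Ioc n 0, (b k : ℝ≥0∞)⁻¹ := by
  have hτ : ∀ k, (if k ≤ 0 then 0 else s k) < b k := fun k => by
    split_ifs
    · exact Nat.pos_of_ne_zero (NeZero.ne _)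
    · exact s.digit_lt k
  let τ₀ : {τ : Address b // ∀ k ≤ 0, τ k = 0} :=
    ⟨⟨fun k => if k ≤ 0 then 0 else s k, hτ, by
      filter_upwards [s.eventually_zero] with k hk
      simp [hk]⟩, fun k hk => if_pos hk⟩
  rw [Address.measure, Measure.sum_apply _ (measurableSet_cylinder s n), tsum_eq_single τ₀]
  · rw [Measure.map_apply (measurable_splice _) (measurableSet_cylinder s n)]
    have : splice τ₀.1 ⁻¹' s.cylinder n =
        Set.pi (Finset.Ioc n 0 : Finset ℤ) fun k => {(⟨s k, s.digit_lt k⟩ : Fin (b k))} := by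
      ext ω
      simp only [cylinder, splice, Set.mem_preimage, Set.mem_ofPred_eq, Set.mem_pi,
        Finset.mem_coe, Finset.mem_Ioc, Set.mem_singleton_iff, Fin.ext_iff, τ₀]
      refine ⟨fun h k hk => by simpa [hk.2] using h k hk.1, fun h k hk => ?_⟩
      by_cases hk0 : k ≤ 0
      · simpa [hk0] using h k ⟨hk, hk0⟩
      · simp [hk0]
    rw [this, Measure.infinitePi_pi _ fun k _ => measurableSet_singleton _]
    refine Finset.prod_congr rfl fun k _ => ?_
    rw [ProbabilityTheory.uniformOn_univ]
    simp
  · intro τ hne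
    rw [Measure.map_apply (measurable_splice _) (measurableSet_cylinder s n)]
    have : splice τ.1 ⁻¹' s.cylinder n = ∅ := by
      by_contra hc
      obtain ⟨ω, hω⟩ := Set.nonempty_iff_ne_empty.2 hc
      refine hne (Subtype.ext (Address.ext (funext fun k => ?_)))
      by_cases hk : k ≤ 0
      · simp [τ₀, hk, τ.2 k hk]
      · have := hω k (by omega)
        simpa [splice, hk, τ₀] using this
    rw [this, measure_empty]

theorem measure_cylinder_of_nonneg (s : Address b) (n : ℕ) :
    Address.measure b (s.cylinder n) = ∏ k ∈ Finset.Ioc 0 (n : ℤ), (b k : ℝ≥0∞) := by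
  induction n generalizing s with
  | zero => simpa using measure_cylinder_of_nonpos s le_rfl
  | succ n ih =>
    let s' : Fin (b (n + 1 : ℕ)) → Address b := fun i =>
      ⟨Function.update s.digit (n + 1 : ℕ) i, fun k => by
        by_cases hk : k = (n + 1 : ℕ)
        · subst hk; simp
        · rw [Function.update_of_ne hk]; exact s.digit_lt k, by
        filter_upwards [s.eventually_zero, eventually_gt_atTop ((n + 1 : ℕ) : ℤ)] with k h1 h2
        rw [Function.update_of_ne h2.ne', h1]⟩
    have hU : s.cylinder (n + 1 : ℕ) = ⋃ i, (s' i).cylinder n := by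
      ext t
      simp only [cylinder, Set.mem_ofPred_eq, Set.mem_iUnion, s']
      constructor
      · intro h
        refine ⟨⟨t _, t.digit_lt _⟩, fun k hk => ?_⟩
        by_cases hk' : k = (n + 1 : ℕ)
        · subst hk'; simp
        · rw [Function.update_of_ne hk']; exact h k (by push_cast at hk' ⊢; omega)
      · rintro ⟨i, h⟩ k hk
        rw [h k (by push_cast at hk; omega), Function.update_of_ne hk.ne']
    have hd : Pairwise (Function.onFun Disjoint fun i => (s' i).cylinder (n : ℤ)) := by
      intro i j hij
      refine Set.disjoint_left.2 fun t hi hj => hij (Fin.ext ?_)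
      have h1 := hi ((n + 1 : ℕ) : ℤ) (by push_cast; omega)
      have h2 := hj ((n + 1 : ℕ) : ℤ) (by push_cast; omega)
      simp only [s', Function.update_self] at h1 h2
      exact h1.symm.trans h2
    rw [hU, measure_iUnion hd fun i => measurableSet_cylinder _ _]
    simp_rw [ih]
    rw [tsum_fintype, Finset.sum_const, Finset.card_univ, Fintype.card_fin, nsmul_eq_mul,
      show Finset.Ioc 0 ((n + 1 : ℕ) : ℤ) = insert ((n + 1 : ℕ) : ℤ) (Finset.Ioc 0 (n : ℤ)) by
        ext k; simp only [Finset.mem_Ioc, Finset.mem_insert]; push_cast; omega,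
      Finset.prod_insert (by simp)]

/-- The cylinders of level `n` have measure `V (2 ^ n)`. -/
theorem measure_cylinder (s : Address b) (n : ℤ) :
    Address.measure b (s.cylinder n) = ENNReal.ofReal (b.vol ((2 : ℝ) ^ n)) := by
  have hpos : ∀ k, (0 : ℝ) < b k := fun k =>
    Nat.cast_pos.2 (Nat.pos_of_ne_zero (NeZero.ne (b k)))
  have hlog : Int.log 2 ((2 : ℝ) ^ n) = n := by
    exact_mod_cast Int.log_zpow (R := ℝ) (b := 2) (by norm_num) n
  simp only [BranchingFunction.vol, hlog]
  split_ifs with h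
  · rw [measure_cylinder_of_nonpos s (by omega), ← Finset.prod_inv_distrib,
      ENNReal.ofReal_prod_of_nonneg fun k _ => (inv_pos.2 (hpos k)).le]
    refine Finset.prod_congr (by ext k; simp only [Finset.mem_Ioc, Finset.mem_Icc]; omega)
      fun k _ => ?_
    rw [ENNReal.ofReal_inv_of_pos (hpos k), ENNReal.ofReal_natCast]
  · obtain ⟨m, rfl⟩ := Int.eq_ofNat_of_zero_le (show 0 ≤ n by omega)
    rw [measure_cylinder_of_nonneg, ENNReal.ofReal_prod_of_nonneg fun k _ => (hpos k).le]
    refine Finset.prod_congr (by ext k; simp only [Finset.mem_Ioc, Finset.mem_Icc]; omega)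
      fun k _ => ?_
    rw [ENNReal.ofReal_natCast]

end Address

/-- Every `n`-cell has diameter at most `2 ^ n`. -/
theorem GluingLabels.treeDist_le_of_mem_cylinder {b : BranchingFunction} (L : GluingLabels b)
    {s t : Address b} {n : ℤ} (h : t ∈ s.cylinder n) : L.treeDist s t ≤ (2 : ℝ) ^ n := by
  by_cases hst : s = t
  · rw [GluingLabels.treeDist, if_pos hst]; positivity
  · have hle : topLevel s t ≤ n := by
      by_contra hc
      exact (topLevel_spec hst).1 (h _ (by omega)).symm
    have h1 := L.tipDist_le (topLevel s t - 1) (L.inner (topLevel s t - 1)) s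
    have h2 := L.tipDist_le (topLevel s t - 1) (L.inner (topLevel s t - 1)) t
    have h3 : (2 : ℝ) ^ (topLevel s t) ≤ (2 : ℝ) ^ n := zpow_le_zpow_right₀ (by norm_num) hle
    rw [zpow_sub_one₀ (by norm_num)] at h1 h2
    rw [L.treeDist_of_ne hst]
    linarith

theorem Address.countable_range_cylinder (b : BranchingFunction) (n : ℤ) :
    (Set.range fun s : Address b => s.cylinder n).Countable := by
  -- a cylinder is determined by the finitely supported function of its digits above `n`
  let F : (ℤ →₀ ℕ) → Set (Address b) := fun f => {t | ∀ k, n < k → t k = f k}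
  refine (Set.countable_range F).mono ?_
  rintro _ ⟨s, rfl⟩
  obtain ⟨N, hN⟩ := eventually_atTop.1 s.eventually_zero
  refine ⟨Finsupp.onFinset (Finset.Ioc n N) (fun k => if n < k then s k else 0) fun k hk => ?_, ?_⟩
  · simp only [ne_eq, ite_eq_right_iff, Classical.not_imp] at hk
    refine Finset.mem_Ioc.2 ⟨hk.1, ?_⟩
    by_contra hc
    exact hk.2 (hN k (by omega))
  · ext t
    simp only [F, Address.cylinder, Set.mem_ofPred_eq, Finsupp.onFinset_apply]
    exact forall₂_congr fun k hk => by rw [if_pos hk]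

theorem GluingLabels.measurable_proj {b : BranchingFunction} (L : GluingLabels b) :
    Measurable L.proj := by
  refine measurable_of_isOpen fun U hU => ?_
  have : L.proj ⁻¹' U = ⋃ (n : ℤ), ⋃₀ {C | C ∈ Set.range (fun s : Address b => s.cylinder n) ∧
      C ⊆ L.proj ⁻¹' U} := by
    apply Set.Subset.antisymm
    · intro s hs
      obtain ⟨ε, hε, hball⟩ := Metric.isOpen_iff.1 hU _ hs
      obtain ⟨n, hn⟩ := exists_pow_lt_of_lt_one hε (show (1 / 2 : ℝ) < 1 by norm_num)
      refine Set.mem_iUnion.2 ⟨-n, s.cylinder (-n), ⟨⟨s, rfl⟩, fun t ht => hball ?_⟩,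
        fun k _ => rfl⟩
      rw [Metric.mem_ball, dist_comm, L.dist_proj]
      refine (L.treeDist_le_of_mem_cylinder ht).trans_lt ?_
      rwa [zpow_neg, zpow_natCast, ← inv_pow, ← one_div]
    · exact Set.iUnion_subset fun n => Set.sUnion_subset fun C hC => hC.2
  rw [this]
  refine MeasurableSet.iUnion fun n => MeasurableSet.sUnion
    ((Address.countable_range_cylinder b n).mono fun C hC => hC.1) ?_
  rintro _ ⟨⟨s, rfl⟩, -⟩
  exact Address.measurableSet_cylinder s n

/-- The measure `m` on `𝒯(b)`, the image of the measure on `𝒰(b)` under the projection. -/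
def GluingLabels.treeMeasure {b : BranchingFunction} (L : GluingLabels b) : Measure L.Tree :=
  (Address.measure b).map L.proj

/-! ## Calculus on a real tree -/

section Calculus

variable {X : Type*} [MetricSpace X]

/-- The geodesic `[x, y]` of a uniquely geodesic space. -/
def geodesic (x y : X) : Set X := {z | dist x z + dist z y = dist x y}

variable (X) in
/-- The skeleton: the union of all open geodesics `]x, y[`. -/
def skeleton : Set X := ⋃ (x : X) (y : X), geodesic x y \ {x, y}

variable [MeasurableSpace X] [BorelSpace X]

variable (X) in
/-- The length measure: the trace of the one-dimensional Hausdorff measure on the skeleton. -/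
def lengthMeasure : Measure X := (Measure.hausdorffMeasure 1).restrict (skeleton X)

/-- Locally absolutely continuous functions. -/
def LocallyAbsCont (f : X → ℝ) : Prop :=
  Continuous f ∧
  ∀ ε : ℝ, 0 < ε → ∀ S : Set X, MeasurableSet S → 0 < lengthMeasure X S → lengthMeasure X S < ∞ →
    ∃ δ : ℝ, 0 < δ ∧ ∀ (n : ℕ) (t s : Fin n → X),
      Pairwise (fun k l => Disjoint (geodesic (t k) (s k)) (geodesic (t l) (s l))) →
      (∀ k, geodesic (t k) (s k) ⊆ S) →
      ∑ k, dist (t k) (s k) < δ → ∑ k, |f (t k) - f (s k)| < ε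

/-- The point `c = c(x, y, z)` with `[x, y] ∩ [x, z] = [x, c]`, which exists and is unique in a
real tree. -/
def branchPoint (x y z : X) : X :=
  @Classical.epsilon X ⟨x⟩ fun c => geodesic x y ∩ geodesic x z = geodesic x c

/-- The oriented integral `∫_x^y g` with respect to the length measure, for the root `ρ`:
the integral over `[x ∧ y, y]` minus the integral over `[x ∧ y, x]`, with `x ∧ y = c(ρ, x, y)`. -/
def orientedIntegral (ρ : X) (g : X → ℝ) (x y : X) : ℝ :=
  (∫ z in geodesic (branchPoint ρ x y) y, g z ∂lengthMeasure X)
    - ∫ z in geodesic (branchPoint ρ x y) x, g z ∂lengthMeasure X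

/-- `g` is a gradient of `f`: it is measurable, integrable on all geodesics, and
`f y - f x = ∫_x^y g` for all `x`, `y`. -/
def IsGradient (ρ : X) (f g : X → ℝ) : Prop :=
  AEStronglyMeasurable g (lengthMeasure X) ∧
  (∀ x y, IntegrableOn g (geodesic x y) (lengthMeasure X)) ∧
  ∀ x y, f y - f x = orientedIntegral ρ g x y

open Classical in
/-- The gradient of `f`, well defined up to null sets of the length measure when `f` is locally
absolutely continuous on a real tree. -/
def treeGradient (ρ : X) (f : X → ℝ) : X → ℝ :=
  if h : ∃ g, IsGradient ρ f g then h.choose else 0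

/-- `∫_A |f|^p |∇φ|^p dλ`. -/
def weightedEnergyOn (ρ : X) (p : ℝ) (A : Set X) (f φ : X → ℝ) : ℝ≥0∞ :=
  ∫⁻ z in A, ENNReal.ofReal (|f z| ^ p * |treeGradient ρ φ z| ^ p) ∂lengthMeasure X

/-- `∫_A |∇f|^p dλ`. -/
def energyOn (ρ : X) (p : ℝ) (A : Set X) (f : X → ℝ) : ℝ≥0∞ :=
  ∫⁻ z in A, ENNReal.ofReal (|treeGradient ρ f z| ^ p) ∂lengthMeasure X

/-- The `p`-energy `ℰ(f) = ∫ |∇f|^p dλ`. -/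
def energy (ρ : X) (p : ℝ) (f : X → ℝ) : ℝ≥0∞ := energyOn ρ p Set.univ f

/-- The domain `ℱ` of the `p`-energy: locally absolutely continuous functions in `L^p(m)` of
finite `p`-energy. -/
def energyDomain (m : Measure X) (ρ : X) (p : ℝ) : Set (X → ℝ) :=
  {f | MemLp f (ENNReal.ofReal p) m ∧ LocallyAbsCont f ∧ energy ρ p f < ∞}

/-- The capacity between `A₁` and `A₂`: the infimum of the energies of the `φ ∈ ℱ` that equal `1`
in an open neighborhood of `A₁` and `0` in an open neighborhood of `A₂`. -/
def capacity (m : Measure X) (ρ : X) (p : ℝ) (A₁ A₂ : Set X) : ℝ≥0∞ :=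
  ⨅ (φ : X → ℝ) (_ : φ ∈ energyDomain m ρ p)
    (_ : ∃ U : Set X, IsOpen U ∧ A₁ ⊆ U ∧ ∀ z ∈ U, φ z = 1)
    (_ : ∃ U : Set X, IsOpen U ∧ A₂ ⊆ U ∧ ∀ z ∈ U, φ z = 0), energy ρ p φ

end Calculus

end

/-! The estimates hold on every proper real tree in which balls of radius `r` have measure
comparable to `V r`; `exists_cutoff_energy_le` proves them there. Fix a ball `B(x, r)` and choose a
maximal `2r`-separated set `F` in the sphere of radius `7r` around `x`. The balls of radius `r`
about `F` are disjoint and lie in `B(x, 8r)`, so comparing volumes bounds the cardinality of `F`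
uniformly (`exists_finset_sphere`). Let `φ` decrease linearly from `1` to `0` between the distances
`r` and `6r` along each `[x, w]`, `w ∈ F`, and be extended so that it is locally constant off these
geodesics (`exists_cutoff`). Every geodesic leaving `B(x, 7r)` follows some `[x, w]` up to distance
`6r`, hence `φ = 0` outside that ball. The gradient is at most `1 / (5r)` and lives on a set of
length at most a constant times `r`, which gives energy `≲ r ^ (1 - p)`. The same function is a
competitor for the capacity.

For the weighted inequality, the fundamental theorem along geodesics, Hölder's inequality and an
average over `B(x, r)` bound `|f| ^ p` at each point of `B(x, 8r)` by the energy and the `L^p` norm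
of `f` on `B(x, 8r)` (`enorm_rpow_le_of_mem_ball`). Multiplying this bound by the energy of `φ`
finishes the argument.

Gradients are handled along geodesics from the root. Countably many of these carry the length
measure; on each of them a locally absolutely continuous function is absolutely continuous, and its
derivatives glue to one function (`exists_isGradient`). Conversely every gradient is a.e. this
derivative (`ae_hasDerivAt`), so Lipschitz bounds control it.

The tree `𝒯(b)` satisfies the hypotheses by its cell structure. Recursion over levels gives the
four-point condition; gluing of subcells at centers gives connectedness; each ball lies in one
compact cell, which gives properness. A ball contains a cell of comparable size and is covered by
boundedly many of them (`measure_treeDist_lt_le`), which gives the volume bounds. -/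

noncomputable section

/-! ### Geodesics in real trees -/

section RealTree

/-- A real tree, characterized as a connected metric space satisfying the four-point condition. -/
structure IsRealTree (X : Type*) [MetricSpace X] : Prop where
  four_point : ∀ x y z w : X,
    dist x y + dist z w ≤ max (dist x z + dist y w) (dist x w + dist y z)
  preconnected : PreconnectedSpace X

theorem left_mem_geodesic {X : Type*} [MetricSpace X] (x y : X) : x ∈ geodesic x y := by
  simp [geodesic]

theorem right_mem_geodesic {X : Type*} [MetricSpace X] (x y : X) : y ∈ geodesic x y := by
  simp [geodesic]

theorem mem_geodesic {X : Type*} [MetricSpace X] {x y z : X} :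
    z ∈ geodesic x y ↔ dist x z + dist z y = dist x y := Iff.rfl

theorem geodesic_comm {X : Type*} [MetricSpace X] (x y : X) : geodesic x y = geodesic y x := by
  ext z
  rw [mem_geodesic, mem_geodesic, dist_comm x y, dist_comm x z, dist_comm z y, add_comm]

theorem geodesic_self {X : Type*} [MetricSpace X] (x : X) : geodesic x x = {x} := by
  ext z
  rw [mem_geodesic, dist_self, dist_comm z x, mem_singleton_iff, ← two_mul]
  simp [eq_comm]

theorem isClosed_geodesic {X : Type*} [MetricSpace X] (x y : X) : IsClosed (geodesic x y) :=
  isClosed_eq (by fun_prop) (by fun_prop)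

theorem geodesic_subset_of_mem {X : Type*} [MetricSpace X] {x y c : X} (hc : c ∈ geodesic x y) :
    geodesic x c ⊆ geodesic x y := by
  intro z hz
  rw [mem_geodesic] at *
  have h1 := dist_triangle z c y
  have h2 := dist_triangle x z y
  linarith

theorem dist_le_of_mem_geodesic {X : Type*} [MetricSpace X] {x y z : X} (h : z ∈ geodesic x y) :
    dist x z ≤ dist x y := by
  have := mem_geodesic.1 h
  have := dist_nonneg (x := z) (y := y)
  linarith

/-- The point of the geodesic `[x, y]` at distance `t` from `x`, with `t` clamped to
`[0, dist x y]`. -/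
def geodesicPoint {X : Type*} [MetricSpace X] (x y : X) (t : ℝ) : X :=
  @Classical.epsilon X ⟨x⟩ fun z => z ∈ geodesic x y ∧ dist x z = max 0 (min t (dist x y))

namespace IsRealTree

variable {X : Type*} [MetricSpace X] (hX : IsRealTree X)

include hX

/-- Near a point off the geodesic `[x, y]`, the difference of the distances to `x` and `y` is
constant. -/
theorem dist_sub_dist_eq {x y z z' : X}
    (h : 2 * dist z z' < dist x z + dist z y - dist x y) :
    dist x z' - dist z' y = dist x z - dist z y := by
  have t1 := dist_triangle x z' z
  have t2 := dist_triangle y z' z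
  have t3 := dist_triangle x z z'
  have t4 := dist_triangle y z z'
  have f1 := hX.four_point x z' y z
  have f2 := hX.four_point x z y z'
  simp only [dist_comm z' z, dist_comm z' y, dist_comm z y] at *
  -- In each four-point inequality the alternative containing `dist x y + dist z z'` contradicts
  -- `h`; the two remaining alternatives are the two halves of the equality.
  rcases le_max_iff.1 f1 with f1 | f1 <;> rcases le_max_iff.1 f2 with f2 | f2 <;>
    linarith

/-- Connectedness: without such a point the closed set `{dist x z - dist z y ≤ 2 * t - dist x y}`
would also be open, because `dist x z - dist z y` is locally constant off `[x, y]`. It contains `x`,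
and it contains `y` only if `t = dist x y`. -/
theorem exists_mem_geodesic (x y : X) {t : ℝ} (h0 : 0 ≤ t) (h1 : t ≤ dist x y) :
    ∃ z ∈ geodesic x y, dist x z = t := by
  by_contra! hne
  have := hX.preconnected
  have hcont : Continuous fun z : X => dist x z - dist z y := by fun_prop
  have hopen : IsOpen {z : X | dist x z - dist z y ≤ 2 * t - dist x y} := by
    rw [Metric.isOpen_iff]
    intro z hz
    rcases (show dist x z - dist z y ≤ 2 * t - dist x y from hz).lt_or_eq with hlt | heq
    · obtain ⟨ε, hε, hs⟩ := Metric.isOpen_iff.1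
        (isOpen_lt hcont (continuous_const (y := 2 * t - dist x y))) z hlt
      exact ⟨ε, hε, fun w hw => show dist x w - dist w y ≤ _ from
        (show dist x w - dist w y < _ from hs hw).le⟩
    · have hpos : 0 < dist x z + dist z y - dist x y := by
        by_contra hn
        have := dist_triangle x z y
        exact hne z (by rw [mem_geodesic]; linarith) (by linarith)
      refine ⟨(dist x z + dist z y - dist x y) / 2, by linarith, fun w hw => ?_⟩
      have := hX.dist_sub_dist_eq (x := x) (y := y) (z := z) (z' := w)
        (by rw [Metric.mem_ball, dist_comm] at hw; linarith)
      exact (this.trans heq).le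
  have hclopen : IsClopen {z : X | dist x z - dist z y ≤ 2 * t - dist x y} :=
    ⟨isClosed_le hcont continuous_const, hopen⟩
  rcases isClopen_iff.1 hclopen with he | hu
  · have : x ∈ {z : X | dist x z - dist z y ≤ 2 * t - dist x y} := by
      simp only [mem_ofPred_eq, dist_self]; linarith
    rw [he] at this
    exact this
  · have : y ∈ {z : X | dist x z - dist z y ≤ 2 * t - dist x y} := hu ▸ mem_univ y
    simp only [mem_ofPred_eq, dist_self] at this
    exact hne y (right_mem_geodesic x y) (by linarith)

/-- The four-point condition makes `dist x` an isometry from `[x, y]` into the line, so a point of a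
geodesic is determined by its distance from one end. -/
theorem dist_eq_abs {x y z w : X} (hz : z ∈ geodesic x y) (hw : w ∈ geodesic x y) :
    dist z w = |dist x z - dist x w| := by
  rw [mem_geodesic] at hz hw
  apply le_antisymm
  · have f := hX.four_point x y z w
    have a1 := le_abs_self (dist x z - dist x w)
    have a2 := neg_abs_le (dist x z - dist x w)
    simp only [dist_comm y z, dist_comm y w] at *
    rcases le_max_iff.1 f with f | f <;> linarith
  · rw [abs_le]
    have t1 := dist_triangle x z w
    have t2 := dist_triangle x w z
    rw [dist_comm w z] at t2
    constructor <;> linarith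

theorem eq_of_dist_eq {x y z w : X} (hz : z ∈ geodesic x y) (hw : w ∈ geodesic x y)
    (h : dist x z = dist x w) : z = w := by
  have := hX.dist_eq_abs hz hw
  rw [h, sub_self, abs_zero] at this
  exact dist_eq_zero.1 this

theorem geodesicPoint_spec (x y : X) (t : ℝ) :
    geodesicPoint x y t ∈ geodesic x y ∧
      dist x (geodesicPoint x y t) = max 0 (min t (dist x y)) := by
  obtain ⟨z, hz⟩ := hX.exists_mem_geodesic x y (t := max 0 (min t (dist x y))) (le_max_left _ _)
    (max_le dist_nonneg (min_le_right _ _))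
  exact Classical.epsilon_spec (p := fun z => z ∈ geodesic x y ∧
    dist x z = max 0 (min t (dist x y))) ⟨z, hz⟩

theorem geodesicPoint_mem (x y : X) (t : ℝ) : geodesicPoint x y t ∈ geodesic x y :=
  (hX.geodesicPoint_spec x y t).1

theorem dist_geodesicPoint {x y : X} {t : ℝ} (h : t ∈ Icc 0 (dist x y)) :
    dist x (geodesicPoint x y t) = t := by
  rw [(hX.geodesicPoint_spec x y t).2, min_eq_left h.2, max_eq_right h.1]

theorem geodesicPoint_dist {x y z : X} (h : z ∈ geodesic x y) :
    geodesicPoint x y (dist x z) = z :=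
  hX.eq_of_dist_eq (hX.geodesicPoint_mem x y _) h
    (hX.dist_geodesicPoint ⟨dist_nonneg, dist_le_of_mem_geodesic h⟩)

theorem dist_geodesicPoint_geodesicPoint {x y : X} {s t : ℝ} (hs : s ∈ Icc 0 (dist x y))
    (ht : t ∈ Icc 0 (dist x y)) :
    dist (geodesicPoint x y s) (geodesicPoint x y t) = |s - t| := by
  rw [hX.dist_eq_abs (hX.geodesicPoint_mem x y s) (hX.geodesicPoint_mem x y t),
    hX.dist_geodesicPoint hs, hX.dist_geodesicPoint ht]

theorem lipschitzWith_geodesicPoint (x y : X) : LipschitzWith 1 (geodesicPoint x y) := by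
  refine LipschitzWith.of_dist_le_mul fun s t => ?_
  rw [hX.dist_eq_abs (hX.geodesicPoint_mem x y s) (hX.geodesicPoint_mem x y t),
    (hX.geodesicPoint_spec x y s).2, (hX.geodesicPoint_spec x y t).2, NNReal.coe_one, one_mul,
    Real.dist_eq]
  refine (abs_max_sub_max_le_max _ _ _ _).trans ?_
  rw [sub_self, abs_zero, max_eq_right (abs_nonneg _)]
  refine (abs_min_sub_min_le_max _ _ _ _).trans ?_
  rw [sub_self, abs_zero, max_eq_left (abs_nonneg _)]

theorem continuous_geodesicPoint (x y : X) : Continuous (geodesicPoint x y) :=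
  (hX.lipschitzWith_geodesicPoint x y).continuous

theorem geodesicPoint_image (x y : X) :
    geodesicPoint x y '' Icc 0 (dist x y) = geodesic x y := by
  apply Subset.antisymm
  · rintro _ ⟨t, -, rfl⟩
    exact hX.geodesicPoint_mem x y t
  · intro z hz
    exact ⟨dist x z, ⟨dist_nonneg, dist_le_of_mem_geodesic hz⟩, hX.geodesicPoint_dist hz⟩

/-- The geodesic to a point of `[x, y]` is a part of `[x, y]`, with the same parametrization. -/
theorem geodesicPoint_eq_of_mem {x y z : X} (hz : z ∈ geodesic x y) {t : ℝ}
    (ht : t ≤ dist x z) : geodesicPoint x z t = geodesicPoint x y t := by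
  have h := dist_le_of_mem_geodesic hz
  refine hX.eq_of_dist_eq (geodesic_subset_of_mem hz (hX.geodesicPoint_mem x z t))
    (hX.geodesicPoint_mem x y t) ?_
  rw [(hX.geodesicPoint_spec x z t).2, (hX.geodesicPoint_spec x y t).2, min_eq_left ht,
    min_eq_left (ht.trans h)]

theorem exists_median (x y z : X) :
    ∃ c, c ∈ geodesic x y ∧ c ∈ geodesic x z ∧ c ∈ geodesic y z := by
  have t1 := dist_triangle x y z
  have t2 := dist_triangle x z y
  have t3 := dist_triangle y x z
  rw [dist_comm z y] at t2
  rw [dist_comm y x] at t3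
  -- The median is the point of `[x, y]` whose distance from `x` is the Gromov product of `y` and
  -- `z`.
  obtain ⟨c, hc, hct⟩ := hX.exists_mem_geodesic x y
    (t := (dist x y + dist x z - dist y z) / 2) (by linarith) (by linarith)
  have f := hX.four_point x y c z
  have t4 := dist_triangle x c z
  have t5 := dist_triangle y c z
  rw [mem_geodesic] at hc
  refine ⟨c, hc, ?_, ?_⟩
  · rw [mem_geodesic]
    rw [dist_comm y c] at *
    rcases le_max_iff.1 f with f | f <;> linarith
  · rw [mem_geodesic]
    rw [dist_comm y c] at *
    rcases le_max_iff.1 f with f | f <;> linarith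

theorem geodesic_inter_eq {x y z c : X} (h1 : c ∈ geodesic x y) (h2 : c ∈ geodesic x z)
    (h3 : c ∈ geodesic y z) : geodesic x y ∩ geodesic x z = geodesic x c := by
  apply Subset.antisymm
  · rintro w ⟨hy, hz⟩
    have e := hX.dist_eq_abs hy h1
    have t := dist_triangle y w z
    rw [mem_geodesic] at *
    rw [dist_comm y c] at h3
    rw [dist_comm y w] at t
    rw [abs_of_nonpos (by linarith)] at e
    linarith
  · exact subset_inter (geodesic_subset_of_mem h1) (geodesic_subset_of_mem h2)

/-- The point chosen by `branchPoint` is the median, since `[x, c] = [x, c']` forces `c = c'`. -/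
theorem branchPoint_mem (x y z : X) :
    branchPoint x y z ∈ geodesic x y ∧ branchPoint x y z ∈ geodesic x z ∧
      branchPoint x y z ∈ geodesic y z := by
  obtain ⟨c, h1, h2, h3⟩ := hX.exists_median x y z
  have hc := hX.geodesic_inter_eq h1 h2 h3
  have hb : geodesic x y ∩ geodesic x z = geodesic x (branchPoint x y z) :=
    Classical.epsilon_spec (p := fun c => geodesic x y ∩ geodesic x z = geodesic x c) ⟨c, hc⟩
  have e : branchPoint x y z = c := by
    have m1 : c ∈ geodesic x (branchPoint x y z) := by
      rw [← hb, hc]; exact right_mem_geodesic x c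
    have m2 : branchPoint x y z ∈ geodesic x c := by
      rw [← hc, hb]; exact right_mem_geodesic x _
    exact hX.eq_of_dist_eq m2 (right_mem_geodesic x c)
      (le_antisymm (dist_le_of_mem_geodesic m2) (dist_le_of_mem_geodesic m1))
  rw [e]
  exact ⟨h1, h2, h3⟩

/-- Convexity of balls keeps the energy in the Poincaré inequality on the ball itself, without
enlarging it. -/
theorem geodesic_subset_ball {x y z : X} {R : ℝ} (hy : y ∈ Metric.ball x R)
    (hz : z ∈ Metric.ball x R) : geodesic y z ⊆ Metric.ball x R := by
  intro w hw
  have f := hX.four_point y z x w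
  rw [Metric.mem_ball'] at *
  rw [mem_geodesic] at hw
  rw [dist_comm y x, dist_comm z x, dist_comm z w] at f
  have := dist_nonneg (x := w) (y := z)
  have := dist_nonneg (x := y) (y := w)
  rcases le_max_iff.1 f with f | f <;> linarith

theorem mem_geodesic_or (ρ : X) {x y z : X} (hz : z ∈ geodesic x y) :
    z ∈ geodesic ρ x ∨ z ∈ geodesic ρ y := by
  have f := hX.four_point x y ρ z
  have t1 := dist_triangle ρ z x
  have t2 := dist_triangle ρ z y
  simp only [mem_geodesic] at *
  rw [dist_comm x ρ, dist_comm x z, dist_comm y ρ, dist_comm y z] at f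
  rw [dist_comm x z] at hz
  rcases le_max_iff.1 f with f | f
  · left; linarith
  · right; linarith

/-- Moving the far end by less than its distance to `z` does not change the way to `z`. Hence
endpoints in a dense sequence suffice to cover the skeleton. -/
theorem mem_geodesic_of_dist_lt {ρ x x' z : X} (hz : z ∈ geodesic ρ x)
    (h : dist x x' < dist z x) : z ∈ geodesic ρ x' := by
  have f := hX.four_point ρ x z x'
  have t1 := dist_triangle ρ z x'
  have := dist_nonneg (x := z) (y := x')
  rw [mem_geodesic] at *
  rw [dist_comm x z] at f
  rcases le_max_iff.1 f with f | f <;> linarith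

end IsRealTree

end RealTree

/-! ### The length measure on geodesics -/

section LengthMeasure

namespace IsRealTree

variable {X : Type*} [MetricSpace X] (hX : IsRealTree X)

include hX

theorem geodesic_union {x y c : X} (hc : c ∈ geodesic x y) :
    geodesic x c ∪ geodesic c y = geodesic x y := by
  apply Subset.antisymm
  · refine union_subset (geodesic_subset_of_mem hc) ?_
    rw [geodesic_comm c y, geodesic_comm x y]
    exact geodesic_subset_of_mem (geodesic_comm x y ▸ hc)
  · intro z hz
    have e := hX.dist_eq_abs hz hc
    rw [mem_geodesic] at hz hc
    rcases le_total (dist x z) (dist x c) with h | h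
    · left
      rw [abs_of_nonpos (by linarith)] at e
      rw [mem_geodesic]; linarith
    · right
      rw [abs_of_nonneg (by linarith)] at e
      rw [mem_geodesic, dist_comm c z]; linarith

omit hX in
theorem geodesic_inter_subset {x y c : X} (hc : c ∈ geodesic x y) :
    geodesic x c ∩ geodesic c y ⊆ {c} := by
  rintro z ⟨h1, h2⟩
  have t := dist_triangle x z y
  have n := dist_nonneg (x := z) (y := c)
  rw [mem_geodesic] at *
  rw [dist_comm c z] at h2
  exact dist_le_zero.1 (by linarith)

variable [MeasurableSpace X] [BorelSpace X]

/-- The parametrization of `[x, y]` and its inverse `dist x` are both `1`-Lipschitz, and neither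
increases Hausdorff measure. -/
theorem hausdorffMeasure_restrict_geodesic (x y : X) :
    (Measure.hausdorffMeasure 1 : Measure X).restrict (geodesic x y) =
      (volume.restrict (Icc 0 (dist x y))).map (geodesicPoint x y) := by
  have hm := (hX.continuous_geodesicPoint x y).measurable
  ext A hA
  rw [Measure.restrict_apply hA, Measure.map_apply hm hA, Measure.restrict_apply (hm hA)]
  have e1 : A ∩ geodesic x y =
      geodesicPoint x y '' (geodesicPoint x y ⁻¹' A ∩ Icc 0 (dist x y)) := by
    rw [image_preimage_inter, hX.geodesicPoint_image]
  have e2 : geodesicPoint x y ⁻¹' A ∩ Icc 0 (dist x y) = dist x '' (A ∩ geodesic x y) := by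
    ext t
    constructor
    · rintro ⟨h1, h2⟩
      exact ⟨_, ⟨h1, hX.geodesicPoint_mem x y t⟩, hX.dist_geodesicPoint h2⟩
    · rintro ⟨z, ⟨h1, h2⟩, rfl⟩
      refine ⟨?_, dist_nonneg, dist_le_of_mem_geodesic h2⟩
      rwa [mem_preimage, hX.geodesicPoint_dist h2]
  apply le_antisymm
  · rw [e1]
    refine ((hX.lipschitzWith_geodesicPoint x y).hausdorffMeasure_image_le zero_le_one _).trans ?_
    rw [hausdorffMeasure_real]
    simp
  · rw [e2, ← hausdorffMeasure_real]
    refine ((LipschitzWith.dist_right x).hausdorffMeasure_image_le zero_le_one _).trans ?_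
    simp

omit hX in
instance nullSingletonClass_lengthMeasure : NullSingletonClass (lengthMeasure X) := by
  have := Measure.nullSingletonClass_hausdorff X (d := 1) one_pos
  rw [lengthMeasure]
  infer_instance

theorem lengthMeasure_restrict_geodesic (x y : X) :
    (lengthMeasure X).restrict (geodesic x y) =
      (volume.restrict (Icc 0 (dist x y))).map (geodesicPoint x y) := by
  have := Measure.nullSingletonClass_hausdorff X (d := 1) one_pos
  rw [← hX.hausdorffMeasure_restrict_geodesic, lengthMeasure,
    Measure.restrict_restrict (isClosed_geodesic x y).measurableSet]
  refine Measure.restrict_congr_set (EventuallyLE.antisymm inter_subset_left.eventuallyLE ?_)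
  rw [ae_le_set]
  -- Only the two endpoints of `[x, y]` can lie outside the skeleton.
  refine measure_mono_null (t := {x, y}) ?_ (Set.Finite.measure_zero (by simp) _)
  rintro z ⟨h1, h2⟩
  by_contra hc
  exact h2 ⟨h1, mem_iUnion.2 ⟨x, mem_iUnion.2 ⟨y, h1, hc⟩⟩⟩

theorem lengthMeasure_geodesic (x y : X) :
    lengthMeasure X (geodesic x y) = ENNReal.ofReal (dist x y) := by
  rw [← Measure.restrict_apply_univ, hX.lengthMeasure_restrict_geodesic,
    Measure.map_apply (hX.continuous_geodesicPoint x y).measurable MeasurableSet.univ]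
  simp

/-- As `q` may be nonmeasurable, the converse is not read off the image measure: a null set of
parameters has a null image because the parametrization is Lipschitz. -/
theorem ae_restrict_geodesic_iff {x y : X} {q : X → Prop} :
    (∀ᵐ z ∂(lengthMeasure X).restrict (geodesic x y), q z) ↔
      ∀ᵐ t ∂volume.restrict (Icc 0 (dist x y)), q (geodesicPoint x y t) := by
  constructor
  · intro h
    rw [hX.lengthMeasure_restrict_geodesic] at h
    exact ae_of_ae_map (hX.continuous_geodesicPoint x y).measurable.aemeasurable h
  · intro h
    rw [ae_restrict_iff' measurableSet_Icc, ae_iff] at h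
    rw [ae_restrict_iff' (isClosed_geodesic x y).measurableSet, ae_iff]
    refine Measure.absolutelyContinuous_of_le Measure.restrict_le_self
      (measure_mono_null (t := geodesicPoint x y '' _) ?_ (nonpos_iff_eq_zero.1
        (((hX.lipschitzWith_geodesicPoint x y).hausdorffMeasure_image_le zero_le_one _).trans
          (le_of_eq (by rw [hausdorffMeasure_real, h, mul_zero])))))
    intro z hz
    simp only [mem_ofPred_eq, Classical.not_imp] at hz
    refine ⟨dist x z, ?_, hX.geodesicPoint_dist hz.1⟩
    simp only [mem_ofPred_eq, Classical.not_imp]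
    exact ⟨⟨dist_nonneg, dist_le_of_mem_geodesic hz.1⟩, by rw [hX.geodesicPoint_dist hz.1]; exact hz.2⟩

variable [SecondCountableTopology X]

/-- The length measure is carried by countably many geodesics from the root. -/
theorem exists_lengthMeasure_compl_eq_zero (ρ : X) :
    ∃ y : ℕ → X, lengthMeasure X (⋃ k, geodesic ρ (y k))ᶜ = 0 := by
  have : Nonempty X := ⟨ρ⟩
  refine ⟨TopologicalSpace.denseSeq X, ?_⟩
  rw [lengthMeasure, Measure.restrict_apply
    (MeasurableSet.iUnion fun k => (isClosed_geodesic _ _).measurableSet).compl]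
  refine measure_mono_null (t := ∅) (subset_empty_iff.2 ?_) measure_empty
  rw [← disjoint_iff_inter_eq_empty, disjoint_compl_left_iff_subset]
  refine iUnion_subset fun x => iUnion_subset fun y => ?_
  rintro z ⟨hz, hne⟩
  simp only [mem_insert_iff, mem_singleton_iff, not_or] at hne
  -- A point of the dense sequence closer to `w` than `z` is has `z` on its geodesic from the root.
  have key : ∀ w, z ∈ geodesic ρ w → z ≠ w →
      z ∈ ⋃ k, geodesic ρ (TopologicalSpace.denseSeq X k) := by
    intro w hw hzw
    obtain ⟨k, hk⟩ := (TopologicalSpace.denseRange_denseSeq X).exists_dist_lt w (dist_pos.2 hzw)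
    exact mem_iUnion.2 ⟨k, hX.mem_geodesic_of_dist_lt hw hk⟩
  rcases hX.mem_geodesic_or ρ hz with h | h
  · exact key x h hne.1
  · exact key y h hne.2

theorem ae_lengthMeasure {ρ : X} {q : X → Prop}
    (h : ∀ y, ∀ᵐ z ∂(lengthMeasure X).restrict (geodesic ρ y), q z) :
    ∀ᵐ z ∂lengthMeasure X, q z := by
  obtain ⟨y, hy⟩ := hX.exists_lengthMeasure_compl_eq_zero ρ
  have h1 := (ae_restrict_iUnion_iff _ _).2 fun k => h (y k)
  rw [ae_restrict_iff' (MeasurableSet.iUnion fun k => (isClosed_geodesic _ _).measurableSet)] at h1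
  filter_upwards [h1, measure_eq_zero_iff_ae_notMem.1 hy] with z hz hz'
  exact hz (notMem_compl_iff.1 hz')

theorem aestronglyMeasurable_lengthMeasure {ρ : X} {g : X → ℝ}
    (h : ∀ y, AEStronglyMeasurable g ((lengthMeasure X).restrict (geodesic ρ y))) :
    AEStronglyMeasurable g (lengthMeasure X) := by
  obtain ⟨y, hy⟩ := hX.exists_lengthMeasure_compl_eq_zero ρ
  have h1 := aestronglyMeasurable_iUnion_iff.2 fun k => h (y k)
  rwa [Measure.restrict_eq_self_of_ae_mem] at h1
  filter_upwards [measure_eq_zero_iff_ae_notMem.1 hy] with z hz using notMem_compl_iff.1 hz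

end IsRealTree

end LengthMeasure

/-! ### Existence and uniqueness of the gradient, and Hölder's inequality along geodesics -/

section Gradient

/-- The derivative of `f` at `z` along the geodesic from the root. -/
def rootDeriv {X : Type*} [MetricSpace X] (ρ : X) (f : X → ℝ) (z : X) : ℝ :=
  derivWithin (fun t => f (geodesicPoint ρ z t)) (Iic (dist ρ z)) (dist ρ z)

namespace IsRealTree

variable {X : Type*} [MetricSpace X] (hX : IsRealTree X)

include hX

theorem geodesic_subset_geodesic {x y z w : X} (hz : z ∈ geodesic x y) (hw : w ∈ geodesic x y) :
    geodesic z w ⊆ geodesic x y := by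
  wlog h : dist x z ≤ dist x w generalizing z w
  · rw [geodesic_comm]; exact this hw hz (le_of_not_ge h)
  have e := hX.dist_eq_abs hz hw
  rw [abs_of_nonpos (by linarith)] at e
  have hzw : z ∈ geodesic x w := by rw [mem_geodesic]; linarith
  refine Subset.trans ?_ (geodesic_subset_of_mem hw)
  rw [← hX.geodesic_union hzw]
  exact subset_union_right

theorem dist_mem_uIcc {x y z w v : X} (hz : z ∈ geodesic x y) (hw : w ∈ geodesic x y)
    (hv : v ∈ geodesic z w) : dist x v ∈ uIcc (dist x z) (dist x w) := by
  have hv' := hX.geodesic_subset_geodesic hz hw hv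
  rw [mem_geodesic, hX.dist_eq_abs hz hw, hX.dist_eq_abs hz hv', hX.dist_eq_abs hv' hw] at hv
  rw [mem_uIcc]
  by_contra! hc
  grind

/-- Along a geodesic from the root, the hypothesis of local absolute continuity gives absolute
continuity in the sense of functions on an interval. -/
theorem absolutelyContinuousOnInterval_comp [MeasurableSpace X] [BorelSpace X] {f : X → ℝ}
    (hf : LocallyAbsCont f) (x y : X) :
    AbsolutelyContinuousOnInterval (fun t => f (geodesicPoint x y t)) 0 (dist x y) := by
  rw [absolutelyContinuousOnInterval_iff]
  intro ε hε
  -- `LocallyAbsCont` only speaks of sets of positive length, so a degenerate geodesic is separate.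
  rcases (dist_nonneg (x := x) (y := y)).eq_or_lt with h0 | hpos
  · refine ⟨1, one_pos, fun E hE _ => ?_⟩
    rw [Finset.sum_eq_zero]
    · exact hε
    · intro i hi
      have := hE.1 i hi
      rw [← h0, uIcc_self, mem_singleton_iff, mem_singleton_iff] at this
      rw [this.1, this.2, dist_self]
  -- The bound is taken for `ε / 2` because the limit `θ → 0` below turns `<` into `≤`.
  obtain ⟨δ, hδ, H⟩ := hf.2 (ε / 2) (half_pos hε) (geodesic x y)
    (isClosed_geodesic x y).measurableSet
    (by rw [hX.lengthMeasure_geodesic]; exact ENNReal.ofReal_pos.2 hpos)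
    (by rw [hX.lengthMeasure_geodesic]; exact ENNReal.ofReal_lt_top)
  refine ⟨δ, hδ, fun E hE hlt => ?_⟩
  obtain ⟨n, I⟩ := E
  obtain ⟨hmem, hdisj⟩ := hE
  simp only at hmem hdisj hlt ⊢
  rw [uIcc_of_le hpos.le] at hmem
  -- the nondegenerate intervals, slightly shortened, are disjoint
  let s : Finset ℕ := {i ∈ Finset.range n | (I i).1 ≠ (I i).2}
  let u : ℝ → ℕ → ℝ := fun θ i => (I i).1 + θ * ((I i).2 - (I i).1)
  let v : ℝ → ℕ → ℝ := fun θ i => (I i).2 + θ * ((I i).1 - (I i).2)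
  have hs : ∀ i ∈ s, i ∈ Finset.range n ∧ (I i).1 ≠ (I i).2 := fun i hi => by simpa [s] using hi
  -- Absolute continuity on an interval allows neighbouring intervals to share an endpoint, while
  -- `LocallyAbsCont` needs disjoint closed geodesics. Cutting off the fraction `θ` at both ends
  -- puts each closed interval inside its half-open one.
  have hsub : ∀ θ ∈ Ioo (0 : ℝ) (1 / 2), ∀ i ∈ s,
      uIcc (u θ i) (v θ i) ⊆ uIoc (I i).1 (I i).2 := by
    intro θ hθ i hi
    have hne := (hs i hi).2
    intro w hw
    rw [mem_uIcc] at hw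
    rw [mem_uIoc]
    simp only [u, v] at hw
    rcases lt_or_gt_of_ne hne with h | h
    · left
      constructor <;> rcases hw with hw | hw <;> nlinarith [hθ.1, hθ.2]
    · right
      constructor <;> rcases hw with hw | hw <;> nlinarith [hθ.1, hθ.2]
  have hIcc : ∀ θ ∈ Ioo (0 : ℝ) (1 / 2), ∀ i ∈ s,
      u θ i ∈ Icc 0 (dist x y) ∧ v θ i ∈ Icc 0 (dist x y) := by
    intro θ hθ i hi
    have h1 := hmem i (hs i hi).1
    have h2 : uIoc (I i).1 (I i).2 ⊆ Icc 0 (dist x y) :=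
      uIoc_subset_uIcc.trans (uIcc_subset_Icc h1.1 h1.2)
    exact ⟨h2 (hsub θ hθ i hi left_mem_uIcc), h2 (hsub θ hθ i hi right_mem_uIcc)⟩
  have key : ∀ θ ∈ Ioo (0 : ℝ) (1 / 2),
      ∑ i ∈ s, |f (geodesicPoint x y (u θ i)) - f (geodesicPoint x y (v θ i))| ≤ ε / 2 := by
    intro θ hθ
    let e := s.equivFin
    have hk : ∀ k, ((e.symm k : s) : ℕ) ∈ s := fun k => (e.symm k).2
    have hd : ∀ w i, i ∈ s → w ∈ geodesic (geodesicPoint x y (u θ i)) (geodesicPoint x y (v θ i)) →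
        dist x w ∈ uIoc (I i).1 (I i).2 := by
      intro w i hi hw
      have h := hX.dist_mem_uIcc (hX.geodesicPoint_mem x y _) (hX.geodesicPoint_mem x y _) hw
      rw [hX.dist_geodesicPoint (hIcc θ hθ i hi).1, hX.dist_geodesicPoint (hIcc θ hθ i hi).2] at h
      exact hsub θ hθ i hi h
    have h := H s.card (fun k => geodesicPoint x y (u θ (e.symm k)))
      (fun k => geodesicPoint x y (v θ (e.symm k))) ?_ ?_ ?_
    · rw [← Finset.sum_coe_sort s
        fun i => |f (geodesicPoint x y (u θ i)) - f (geodesicPoint x y (v θ i))|,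
        ← Equiv.sum_comp e.symm]
      exact h.le
    · intro k l hkl
      rw [Set.disjoint_left]
      intro w h1 h2
      have hne : ((e.symm k : s) : ℕ) ≠ (e.symm l : s) := fun h =>
        hkl (e.symm.injective (Subtype.ext h))
      exact Set.disjoint_left.1 (hdisj (Finset.mem_coe.2 (hs _ (hk k)).1)
        (Finset.mem_coe.2 (hs _ (hk l)).1) hne) (hd w _ (hk k) h1) (hd w _ (hk l) h2)
    · intro k
      exact hX.geodesic_subset_geodesic (hX.geodesicPoint_mem x y _) (hX.geodesicPoint_mem x y _)
    · rw [Equiv.sum_comp e.symm fun i : s =>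
        dist (geodesicPoint x y (u θ i)) (geodesicPoint x y (v θ i)),
        Finset.sum_coe_sort s
        fun i => dist (geodesicPoint x y (u θ i)) (geodesicPoint x y (v θ i))]
      refine lt_of_le_of_lt ?_ hlt
      refine (Finset.sum_le_sum fun i hi => ?_).trans
        (Finset.sum_le_sum_of_subset_of_nonneg (Finset.filter_subset _ _)
          fun i _ _ => dist_nonneg)
      rw [hX.dist_geodesicPoint_geodesicPoint (hIcc θ hθ i hi).1 (hIcc θ hθ i hi).2, Real.dist_eq,
        show u θ i - v θ i = (1 - 2 * θ) * ((I i).1 - (I i).2) by simp only [u, v]; ring, abs_mul,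
        abs_of_nonneg (by linarith [hθ.2])]
      exact mul_le_of_le_one_left (abs_nonneg _) (by linarith [hθ.1])
  have hlim : Tendsto (fun θ : ℝ =>
      ∑ i ∈ s, |f (geodesicPoint x y (u θ i)) - f (geodesicPoint x y (v θ i))|) (𝓝[>] 0)
      (𝓝 (∑ i ∈ s, |f (geodesicPoint x y (I i).1) - f (geodesicPoint x y (I i).2)|)) := by
    have hc : Continuous fun θ : ℝ =>
        ∑ i ∈ s, |f (geodesicPoint x y (u θ i)) - f (geodesicPoint x y (v θ i))| := by
      have h1 := hf.1.comp (hX.continuous_geodesicPoint x y)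
      refine continuous_finsetSum _ fun i _ => ?_
      exact ((h1.comp (by fun_prop : Continuous fun θ => u θ i)).sub
        (h1.comp (by fun_prop : Continuous fun θ => v θ i))).abs
    have := (hc.tendsto 0).mono_left (nhdsWithin_le_nhds (s := Ioi 0))
    simpa [u, v] using this
  have hle := le_of_tendsto hlim (by
    filter_upwards [Ioo_mem_nhdsGT (show (0 : ℝ) < 1 / 2 by norm_num)] with θ hθ using key θ hθ)
  refine lt_of_le_of_lt ?_ (half_lt_self hε)
  refine le_trans (le_of_eq ?_) hle
  refine (Finset.sum_subset (Finset.filter_subset _ _) fun i hi hni => ?_).symm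
  have : (I i).1 = (I i).2 := by
    by_contra hc
    exact hni (Finset.mem_filter.2 ⟨hi, hc⟩)
  rw [this, dist_self]

/-- The derivative towards the root only sees `[ρ, z]`, which is common to all geodesics from `ρ`
through `z`. This is why the derivatives along different geodesics define one function on the tree.
-/
theorem rootDeriv_geodesicPoint {ρ y : X} {f : X → ℝ} {t : ℝ} (ht : t ∈ Icc 0 (dist ρ y))
    (hd : DifferentiableAt ℝ (fun t => f (geodesicPoint ρ y t)) t) :
    rootDeriv ρ f (geodesicPoint ρ y t) = deriv (fun t => f (geodesicPoint ρ y t)) t := by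
  rw [rootDeriv, hX.dist_geodesicPoint ht, ← hd.derivWithin (uniqueDiffWithinAt_Iic t)]
  have h : ∀ s ≤ t, f (geodesicPoint ρ (geodesicPoint ρ y t) s) = f (geodesicPoint ρ y s) :=
    fun s hs => by
      rw [hX.geodesicPoint_eq_of_mem (hX.geodesicPoint_mem ρ y t)
        (by rwa [hX.dist_geodesicPoint ht])]
  exact derivWithin_congr (fun s hs => h s hs) (h t le_rfl)

variable [MeasurableSpace X] [BorelSpace X]

omit hX in
theorem aedisjoint_geodesic {x y c : X} (hc : c ∈ geodesic x y) :
    AEDisjoint (lengthMeasure X) (geodesic x c) (geodesic c y) :=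
  measure_mono_null (geodesic_inter_subset hc) (measure_singleton c)

theorem setIntegral_geodesic {x y c : X} (hc : c ∈ geodesic x y) {g : X → ℝ}
    (hg : IntegrableOn g (geodesic x y) (lengthMeasure X)) :
    ∫ z in geodesic x y, g z ∂lengthMeasure X =
      (∫ z in geodesic x c, g z ∂lengthMeasure X) + ∫ z in geodesic c y, g z ∂lengthMeasure X := by
  rw [← hX.geodesic_union hc] at hg ⊢
  exact setIntegral_union₀ (aedisjoint_geodesic hc)
    (isClosed_geodesic c y).measurableSet.nullMeasurableSet
    (hg.mono_set subset_union_left) (hg.mono_set subset_union_right)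

/-- Subtracting the integrals over `[ρ, x]` and `[ρ, y]` cancels the common part up to the branch
point. -/
theorem isGradient_of_root {ρ : X} {f g : X → ℝ} (hg : AEStronglyMeasurable g (lengthMeasure X))
    (hi : ∀ y, IntegrableOn g (geodesic ρ y) (lengthMeasure X))
    (h : ∀ y, f y - f ρ = ∫ z in geodesic ρ y, g z ∂lengthMeasure X) : IsGradient ρ f g := by
  refine ⟨hg, fun x y => ((hi x).union (hi y)).mono_set fun z hz => hX.mem_geodesic_or ρ hz,
    fun x y => ?_⟩
  obtain ⟨h1, h2, -⟩ := hX.branchPoint_mem ρ x y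
  have e1 := h x
  have e2 := h y
  rw [hX.setIntegral_geodesic h1 (hi x)] at e1
  rw [hX.setIntegral_geodesic h2 (hi y)] at e2
  rw [orientedIntegral]
  linarith

theorem sub_root_eq {ρ : X} {f g : X → ℝ} (h : IsGradient ρ f g) (y : X) :
    f y - f ρ = ∫ z in geodesic ρ y, g z ∂lengthMeasure X := by
  have hb := (hX.branchPoint_mem ρ ρ y).1
  rw [geodesic_self, mem_singleton_iff] at hb
  rw [h.2.2 ρ y, orientedIntegral, hb, geodesic_self,
    Measure.restrict_eq_zero.2 (measure_singleton ρ), integral_zero_measure, sub_zero]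

theorem integrableOn_geodesic_iff {x y : X} {g : X → ℝ}
    (hg : AEStronglyMeasurable g ((lengthMeasure X).restrict (geodesic x y))) :
    IntegrableOn g (geodesic x y) (lengthMeasure X) ↔
      IntervalIntegrable (fun t => g (geodesicPoint x y t)) volume 0 (dist x y) := by
  rw [intervalIntegrable_iff_integrableOn_Icc_of_le dist_nonneg, IntegrableOn, IntegrableOn]
  rw [hX.lengthMeasure_restrict_geodesic] at hg ⊢
  exact integrable_map_measure hg (hX.continuous_geodesicPoint x y).measurable.aemeasurable

theorem setIntegral_geodesic_eq {x y : X} {g : X → ℝ}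
    (hg : AEStronglyMeasurable g ((lengthMeasure X).restrict (geodesic x y))) :
    ∫ z in geodesic x y, g z ∂lengthMeasure X =
      ∫ t in (0 : ℝ)..dist x y, g (geodesicPoint x y t) := by
  rw [intervalIntegral.integral_of_le dist_nonneg, ← integral_Icc_eq_integral_Ioc]
  rw [hX.lengthMeasure_restrict_geodesic] at hg ⊢
  exact integral_map (hX.continuous_geodesicPoint x y).measurable.aemeasurable hg

/-- The gradient is `rootDeriv ρ f`: on each geodesic from the root it is a.e. the derivative of an
absolutely continuous function, which integrates back to `f`. -/
theorem exists_isGradient [SecondCountableTopology X] (ρ : X) {f : X → ℝ}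
    (hf : LocallyAbsCont f) : ∃ g, IsGradient ρ f g := by
  have hac := fun y => hX.absolutelyContinuousOnInterval_comp hf ρ y
  have hae : ∀ y, ∀ᵐ t ∂volume.restrict (Icc 0 (dist ρ y)),
      rootDeriv ρ f (geodesicPoint ρ y t) = deriv (fun t => f (geodesicPoint ρ y t)) t := by
    intro y
    rw [ae_restrict_iff' measurableSet_Icc]
    filter_upwards [(hac y).ae_differentiableAt] with t ht h
    exact hX.rootDeriv_geodesicPoint h (ht (by rwa [uIcc_of_le dist_nonneg]))
  have hm : ∀ y, AEStronglyMeasurable (rootDeriv ρ f)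
      ((lengthMeasure X).restrict (geodesic ρ y)) := by
    intro y
    -- On `[ρ, y]` the parameter of `z` is `dist ρ z`, so the comparison function is a derivative on
    -- the line composed with a continuous map.
    refine AEStronglyMeasurable.congr (f := fun z =>
      deriv (fun t => f (geodesicPoint ρ y t)) (dist ρ z))
      ((measurable_deriv _).comp (by fun_prop)).aestronglyMeasurable ?_
    refine hX.ae_restrict_geodesic_iff.2 ?_
    filter_upwards [hae y, ae_restrict_mem measurableSet_Icc] with t h1 h2
    rw [h1, hX.dist_geodesicPoint h2]
  have hae' : ∀ y, ∀ᵐ t ∂volume, t ∈ uIoc 0 (dist ρ y) →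
      rootDeriv ρ f (geodesicPoint ρ y t) = deriv (fun t => f (geodesicPoint ρ y t)) t := by
    intro y
    have := hae y
    rw [ae_restrict_iff' measurableSet_Icc] at this
    filter_upwards [this] with t ht h
    rw [uIoc_of_le dist_nonneg] at h
    exact ht ⟨h.1.le, h.2⟩
  refine ⟨rootDeriv ρ f, hX.isGradient_of_root (hX.aestronglyMeasurable_lengthMeasure hm)
    (fun y => ?_) fun y => ?_⟩
  · rw [hX.integrableOn_geodesic_iff (hm y)]
    refine (hac y).intervalIntegrable_deriv.congr_ae ?_
    rw [EventuallyEq, ae_restrict_iff' measurableSet_uIoc]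
    filter_upwards [hae' y] with t ht h using (ht h).symm
  · rw [hX.setIntegral_geodesic_eq (hm y), intervalIntegral.integral_congr_ae (hae' y),
      (hac y).integral_deriv_eq_sub]
    have h0 : geodesicPoint ρ y 0 = ρ := by
      have := hX.geodesicPoint_dist (left_mem_geodesic ρ y)
      rwa [dist_self] at this
    rw [h0, hX.geodesicPoint_dist (right_mem_geodesic ρ y)]

theorem isGradient_treeGradient [SecondCountableTopology X] (ρ : X) {f : X → ℝ}
    (hf : LocallyAbsCont f) : IsGradient ρ f (treeGradient ρ f) := by
  have h := hX.exists_isGradient ρ hf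
  rw [treeGradient, dif_pos h]
  exact h.choose_spec

/-- A gradient is almost everywhere the derivative along the geodesics from the root. -/
theorem ae_hasDerivAt {ρ : X} {f g : X → ℝ} (h : IsGradient ρ f g) (y : X) :
    ∀ᵐ t ∂volume.restrict (Icc 0 (dist ρ y)),
      HasDerivAt (fun t => f (geodesicPoint ρ y t)) (g (geodesicPoint ρ y t)) t := by
  have hi := (hX.integrableOn_geodesic_iff h.1.restrict).1 (h.2.1 ρ y)
  have hF : ∀ t ∈ Icc 0 (dist ρ y), f (geodesicPoint ρ y t) =
      f ρ + ∫ s in (0 : ℝ)..t, g (geodesicPoint ρ y s) := by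
    intro t ht
    have h1 := hX.sub_root_eq h (geodesicPoint ρ y t)
    rw [hX.setIntegral_geodesic_eq h.1.restrict, hX.dist_geodesicPoint ht] at h1
    rw [← sub_eq_iff_eq_add', h1]
    refine intervalIntegral.integral_congr fun s hs => ?_
    rw [uIcc_of_le ht.1] at hs
    rw [hX.geodesicPoint_eq_of_mem (hX.geodesicPoint_mem ρ y t)
      (by rw [hX.dist_geodesicPoint ht]; exact hs.2)]
  rw [← restrict_Ioo_eq_restrict_Icc, ae_restrict_iff' measurableSet_Ioo]
  filter_upwards [hi.ae_hasDerivAt_integral] with t ht hmem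
  have h1 := (ht (by rw [uIcc_of_le dist_nonneg]; exact Ioo_subset_Icc_self hmem) 0
    left_mem_uIcc).const_add (f ρ)
  refine h1.congr_of_eventuallyEq ?_
  filter_upwards [Ioo_mem_nhds hmem.1 hmem.2] with s hs using hF s (Ioo_subset_Icc_self hs)

/-- Geodesics are `1`-Lipschitz, so a local Lipschitz bound passes to the derivative along them. It
is applied to the cutoff on the whole space, and with `K = 0` where the cutoff is locally constant.
-/
theorem ae_abs_le [SecondCountableTopology X] {ρ : X} {f g : X → ℝ} (h : IsGradient ρ f g)
    {U : Set X} {K : ℝ} (hK : 0 ≤ K)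
    (hU : ∀ z ∈ U, ∀ᶠ z' in 𝓝 z, |f z' - f z| ≤ K * dist z' z) :
    ∀ᵐ z ∂lengthMeasure X, z ∈ U → |g z| ≤ K := by
  refine hX.ae_lengthMeasure (ρ := ρ) fun y => hX.ae_restrict_geodesic_iff.2 ?_
  filter_upwards [hX.ae_hasDerivAt h y] with t ht hmem
  refine ht.le_of_lip' hK ?_
  filter_upwards [(hX.continuous_geodesicPoint ρ y).continuousAt.eventually (hU _ hmem)] with s hs
  refine hs.trans (mul_le_mul_of_nonneg_left ?_ hK)
  simpa [Real.dist_eq] using (hX.lipschitzWith_geodesicPoint ρ y).dist_le_mul s t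

theorem enorm_sub_le {ρ : X} {f g : X → ℝ} (h : IsGradient ρ f g) (x y : X) :
    ‖f y - f x‖ₑ ≤ ∫⁻ z in geodesic x y, ‖g z‖ₑ ∂lengthMeasure X := by
  have hb := (hX.branchPoint_mem ρ x y).2.2
  rw [h.2.2 x y, orientedIntegral, ← hX.geodesic_union hb]
  set c := branchPoint ρ x y
  have hu : ∫⁻ z in geodesic x c ∪ geodesic c y, ‖g z‖ₑ ∂lengthMeasure X =
      (∫⁻ z in geodesic x c, ‖g z‖ₑ ∂lengthMeasure X) +
        ∫⁻ z in geodesic c y, ‖g z‖ₑ ∂lengthMeasure X := by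
    rw [Measure.restrict_union₀ (aedisjoint_geodesic hb)
      (isClosed_geodesic c y).measurableSet.nullMeasurableSet, lintegral_add_measure]
  rw [hu, add_comm, geodesic_comm x c]
  refine (_root_.enorm_sub_le).trans (add_le_add ?_ ?_) <;> exact enorm_integral_le_lintegral_enorm _

/-- Hölder's inequality against the constant `1` on `[x, y]`; the power of the length is `p / q = p
- 1` for the conjugate exponent `q`. -/
theorem enorm_sub_rpow_le {ρ : X} {f g : X → ℝ} (h : IsGradient ρ f g) {p : ℝ} (hp : 1 < p)
    (x y : X) :
    ‖f y - f x‖ₑ ^ p ≤ ENNReal.ofReal (dist x y) ^ (p - 1) *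
      ∫⁻ z in geodesic x y, ‖g z‖ₑ ^ p ∂lengthMeasure X := by
  have hp0 : 0 < p := by linarith
  have hpq : p.HolderConjugate (p / (p - 1)) := by
    rw [Real.holderConjugate_iff]
    refine ⟨hp, ?_⟩
    rw [inv_div]
    field_simp
    ring
  have hm : AEMeasurable (fun z => ‖g z‖ₑ) ((lengthMeasure X).restrict (geodesic x y)) :=
    h.1.restrict.enorm
  have h1 := ENNReal.lintegral_mul_le_Lp_mul_Lq _ hpq hm (aemeasurable_const (b := (1 : ℝ≥0∞)))
  simp only [Pi.mul_apply, mul_one, ENNReal.one_rpow, lintegral_const, one_mul,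
    Measure.restrict_apply_univ, hX.lengthMeasure_geodesic] at h1
  refine (ENNReal.rpow_le_rpow ((hX.enorm_sub_le h x y).trans h1) hp0.le).trans (le_of_eq ?_)
  rw [ENNReal.mul_rpow_of_nonneg _ _ hp0.le, ← ENNReal.rpow_mul, ← ENNReal.rpow_mul,
    one_div_mul_cancel hp0.ne', ENNReal.rpow_one, mul_comm]
  congr 2
  rw [one_div_div]
  field_simp

end IsRealTree

end Gradient

/-! ### Cutoff functions and their energy estimates -/

section Cutoff

theorem ofReal_abs_rpow (a : ℝ) {p : ℝ} (hp : 0 ≤ p) : ENNReal.ofReal (|a| ^ p) = ‖a‖ₑ ^ p := by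
  rw [Real.enorm_eq_ofReal_abs, ENNReal.ofReal_rpow_of_nonneg (abs_nonneg a) hp]

/-- The Gromov product of `z` and `w` with respect to the base point `x`: the distance from `x` at
which the geodesics to `z` and to `w` separate. -/
def gromovProduct {X : Type*} [MetricSpace X] (x z w : X) : ℝ :=
  (dist x z + dist x w - dist z w) / 2

theorem gromovProduct_le {X : Type*} [MetricSpace X] (x z w : X) :
    gromovProduct x z w ≤ dist x z := by
  have := dist_triangle x z w
  rw [gromovProduct]; linarith

theorem abs_gromovProduct_sub_le {X : Type*} [MetricSpace X] (x z z' w : X) :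
    |gromovProduct x z w - gromovProduct x z' w| ≤ dist z z' := by
  have t1 := dist_triangle x z z'
  have t2 := dist_triangle x z' z
  have t3 := dist_triangle z z' w
  have t4 := dist_triangle z' z w
  rw [dist_comm z' z] at t2 t4
  rw [gromovProduct, gromovProduct, abs_le]
  constructor <;> linarith

theorem isCompact_biUnion_geodesic {X : Type*} [MetricSpace X] (hX : IsRealTree X) (x : X)
    (F : Finset X) : IsCompact (⋃ w ∈ F, geodesic x w) := by
  refine F.isCompact_biUnion fun w _ => ?_
  rw [← hX.geodesicPoint_image]
  exact isCompact_Icc.image (hX.continuous_geodesicPoint x w)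

namespace IsRealTree

variable {X : Type*} [MetricSpace X] (hX : IsRealTree X)

include hX

/-- All points near `z` branch off `[x, w]` where `z` does. Functions of the Gromov product thus
have zero gradient off `[x, w]`. -/
theorem eventually_gromovProduct_eq {x w z : X} (hz : z ∉ geodesic x w) :
    ∀ᶠ z' in 𝓝 z, gromovProduct x z' w = gromovProduct x z w := by
  have hpos : 0 < dist x z + dist z w - dist x w := by
    have := dist_triangle x z w
    rcases this.lt_or_eq with h | h
    · linarith
    · exact absurd h.symm hz
  filter_upwards [Metric.ball_mem_nhds z (half_pos hpos)] with z' hz'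
  rw [Metric.mem_ball'] at hz'
  have := hX.dist_sub_dist_eq (x := x) (y := w) (z := z) (z' := z') (by linarith)
  rw [gromovProduct, gromovProduct]
  linarith

/-- A cutoff function which decreases linearly along the geodesics from `x` to the points of `F`,
between the distances `r` and `6 * r` from `x`, and is locally constant elsewhere. -/
theorem exists_cutoff (x : X) {r : ℝ} (hr : 0 < r) (F : Finset X) :
    ∃ φ : X → ℝ, (∀ z, 0 ≤ φ z ∧ φ z ≤ 1) ∧
      (∀ z z', |φ z - φ z'| ≤ (5 * r)⁻¹ * dist z z') ∧
      (∀ z, (∀ w ∈ F, gromovProduct x z w ≤ r) → φ z = 1) ∧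
      (∀ z, ∀ w ∈ F, 6 * r ≤ gromovProduct x z w → φ z = 0) ∧
      ∀ z, (∀ w ∈ F, z ∉ geodesic x w) → ∀ᶠ z' in 𝓝 z, φ z' = φ z := by
  classical
  induction F using Finset.induction_on with
  | empty =>
    refine ⟨fun _ => 1, fun _ => by simp, fun z z' => ?_, by simp, by simp, by simp⟩
    rw [sub_self, abs_zero]; positivity
  | insert w F _ ih =>
    obtain ⟨φ, h1, h2, h3, h4, h5⟩ := ih
    -- The ramp is `1` at Gromov product `r` and `0` from `6 * r` on; it may exceed `1`, which the
    -- minimum with `φ ≤ 1` corrects.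
    let ψ : X → ℝ := fun z => max 0 ((5 * r)⁻¹ * (6 * r - gromovProduct x z w))
    have hψ : ∀ z z', |ψ z - ψ z'| ≤ (5 * r)⁻¹ * dist z z' := by
      intro z z'
      refine (abs_max_sub_max_le_max _ _ _ _).trans ?_
      rw [sub_self, abs_zero, max_eq_right (abs_nonneg _), ← mul_sub, abs_mul,
        abs_of_nonneg (by positivity)]
      refine mul_le_mul_of_nonneg_left ?_ (by positivity)
      rw [sub_sub_sub_cancel_left, abs_sub_comm]
      exact abs_gromovProduct_sub_le x z z' w
    refine ⟨fun z => min (φ z) (ψ z), fun z => ⟨le_min (h1 z).1 (le_max_left _ _),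
      (min_le_left _ _).trans (h1 z).2⟩, fun z z' => ?_, fun z hz => ?_, fun z v hv hz => ?_,
      fun z hz => ?_⟩
    · exact (abs_min_sub_min_le_max _ _ _ _).trans (max_le (h2 z z') (hψ z z'))
    · change min (φ z) (ψ z) = 1
      rw [h3 z fun v hv => hz v (Finset.mem_insert_of_mem hv)]
      refine min_eq_left (le_max_of_le_right ?_)
      have := hz w (Finset.mem_insert_self w F)
      rw [inv_mul_eq_div, le_div_iff₀ (by positivity)]
      linarith
    · rcases Finset.mem_insert.1 hv with rfl | hv
      · change min (φ z) (ψ z) = 0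
        rw [show ψ z = 0 from max_eq_left
          (mul_nonpos_of_nonneg_of_nonpos (by positivity) (by linarith))]
        exact min_eq_right (h1 z).1
      · change min (φ z) (ψ z) = 0
        rw [h4 z v hv hz]
        exact min_eq_left (le_max_left _ _)
    · filter_upwards [h5 z fun v hv => hz v (Finset.mem_insert_of_mem hv),
        hX.eventually_gromovProduct_eq (hz w (Finset.mem_insert_self w F))] with z' e1 e2
      simp only [ψ, e1, e2]

variable [MeasurableSpace X] [BorelSpace X]

omit hX in
theorem locallyAbsCont_of_lipschitz {f : X → ℝ} {K : ℝ} (hK : 0 < K)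
    (h : ∀ z z', |f z - f z'| ≤ K * dist z z') : LocallyAbsCont f := by
  refine ⟨(LipschitzWith.of_dist_le_mul (K := ⟨K, hK.le⟩) h).continuous,
    fun ε hε S _ _ _ => ⟨ε / K, by positivity, fun n t s _ _ hlt => ?_⟩⟩
  refine (Finset.sum_le_sum fun k _ => h (t k) (s k)).trans_lt ?_
  rw [← Finset.mul_sum, mul_comm]
  exact (lt_div_iff₀ hK).1 hlt

omit hX in
/-- A maximal separated set in a sphere is finite, with a bound on its cardinality, when balls of
the radius of separation have comparable measures. -/
theorem exists_finset_sphere {m : Measure X} {x : X} {r c C : ℝ} (hc : 0 < c) (hC : 0 < C)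
    (hlow : ∀ y, ENNReal.ofReal c ≤ m (Metric.ball y r))
    (hup : m (Metric.ball x (8 * r)) ≤ ENNReal.ofReal C) :
    ∃ F : Finset X, (F.card : ℝ) ≤ C / c ∧ (∀ w ∈ F, dist x w = 7 * r) ∧
      ∀ z, dist x z = 7 * r → ∃ w ∈ F, dist z w ≤ 2 * r := by
  classical
  let P : Finset X → Prop := fun F => (∀ w ∈ F, dist x w = 7 * r) ∧
    ∀ w ∈ F, ∀ v ∈ F, w ≠ v → 2 * r < dist w v
  have hcard : ∀ F, P F → (F.card : ℝ) ≤ C / c := by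
    intro F hF
    have hd : (F : Set X).PairwiseDisjoint fun w => Metric.ball w r := by
      intro w hw v hv hne
      refine Metric.ball_disjoint_ball ?_
      have := hF.2 w hw v hv hne
      linarith
    have hsub : (⋃ w ∈ F, Metric.ball w r) ⊆ Metric.ball x (8 * r) := by
      refine iUnion₂_subset fun w hw => Metric.ball_subset_ball' ?_
      rw [dist_comm, hF.1 w hw]; linarith
    have h1 : ∑ _w ∈ F, ENNReal.ofReal c ≤ ENNReal.ofReal C := by
      refine (Finset.sum_le_sum fun w _ => hlow w).trans ?_
      rw [← measure_biUnion_finset hd fun w _ => Metric.isOpen_ball.measurableSet]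
      exact (measure_mono hsub).trans hup
    rw [Finset.sum_const, nsmul_eq_mul, ← ENNReal.ofReal_natCast,
      ← ENNReal.ofReal_mul (Nat.cast_nonneg _), ENNReal.ofReal_le_ofReal_iff hC.le] at h1
    rwa [le_div_iff₀ hc]
  -- The volume bound on cardinalities makes the supremum a maximum; adding a point far from `F`
  -- would then exceed it.
  have hmax : sSup {n | ∃ F, P F ∧ F.card = n} ∈ {n | ∃ F, P F ∧ F.card = n} := by
    refine Nat.sSup_mem ⟨0, ∅, by simp [P], rfl⟩ ⟨⌊C / c⌋₊, ?_⟩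
    rintro _ ⟨F, hF, rfl⟩
    exact Nat.le_floor (hcard F hF)
  have hle : ∀ F, P F → F.card ≤ sSup {n | ∃ F, P F ∧ F.card = n} := by
    intro F hF
    refine le_csSup ⟨⌊C / c⌋₊, ?_⟩ ⟨F, hF, rfl⟩
    rintro _ ⟨F, hF, rfl⟩
    exact Nat.le_floor (hcard F hF)
  obtain ⟨F, hF, hFc⟩ := hmax
  refine ⟨F, hcard F hF, hF.1, fun z hz => ?_⟩
  by_contra! hfar
  have hzF : z ∉ F := fun h => by
    have h1 := hfar z h
    rw [dist_self] at h1
    have h2 := dist_nonneg (x := x) (y := z)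
    linarith
  have := hle (insert z F) ⟨?_, ?_⟩
  · rw [Finset.card_insert_of_notMem hzF] at this
    omega
  · intro w hw
    rcases Finset.mem_insert.1 hw with rfl | hw
    · exact hz
    · exact hF.1 w hw
  · intro w hw v hv hne
    rcases Finset.mem_insert.1 hw with rfl | hw' <;> rcases Finset.mem_insert.1 hv with rfl | hv'
    · exact absurd rfl hne
    · exact hfar v hv'
    · rw [dist_comm]; exact hfar w hw'
    · exact hF.2 w hw' v hv' hne

/-- A pointwise Poincaré inequality. -/
theorem enorm_rpow_le_of_mem_ball {m : Measure X} {ρ : X} {f g : X → ℝ} (h : IsGradient ρ f g)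
    {p : ℝ} (hp : 1 < p) {x y : X} {r a : ℝ} (hr : 0 < r) (ha : 0 < a)
    (hlow : ENNReal.ofReal a ≤ m (Metric.ball x r)) (hfin : m (Metric.ball x r) ≠ ∞)
    (hy : y ∈ Metric.ball x (8 * r)) :
    ‖f y‖ₑ ^ p ≤ ENNReal.ofReal (2 ^ (p - 1)) *
      (ENNReal.ofReal a⁻¹ * (∫⁻ z in Metric.ball x (8 * r), ‖f z‖ₑ ^ p ∂m) +
        ENNReal.ofReal ((16 * r) ^ (p - 1)) *
          ∫⁻ z in Metric.ball x (8 * r), ‖g z‖ₑ ^ p ∂lengthMeasure X) := by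
  set I := ∫⁻ z in Metric.ball x (8 * r), ‖g z‖ₑ ^ p ∂lengthMeasure X
  set J := ∫⁻ z in Metric.ball x (8 * r), ‖f z‖ₑ ^ p ∂m
  have hsub : Metric.ball x r ⊆ Metric.ball x (8 * r) := Metric.ball_subset_ball (by linarith)
  have hQ : ENNReal.ofReal (2 ^ (p - 1)) = 2 ^ (p - 1) := by
    rw [← ENNReal.ofReal_rpow_of_nonneg (by norm_num) (by linarith)]; simp
  -- Compare `f y` with `f z` along `[z, y]`, which stays in the large ball; `16 * r` is a crude
  -- bound for its length. This is then integrated over `z` in the small ball and divided by the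
  -- measure of that ball.
  have hpt : ∀ z ∈ Metric.ball x r, ‖f y‖ₑ ^ p ≤
      ENNReal.ofReal (2 ^ (p - 1)) * (‖f z‖ₑ ^ p + ENNReal.ofReal ((16 * r) ^ (p - 1)) * I) := by
    intro z hz
    have h1 : ‖f y‖ₑ ≤ ‖f z‖ₑ + ‖f y - f z‖ₑ := by
      refine le_trans (le_of_eq ?_) (enorm_add_le _ _)
      rw [add_sub_cancel]
    have hd : dist z y ≤ 16 * r := by
      have := dist_triangle_left z y x
      rw [Metric.mem_ball'] at hy hz
      linarith
    have h2 : ‖f y - f z‖ₑ ^ p ≤ ENNReal.ofReal ((16 * r) ^ (p - 1)) * I := by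
      refine (hX.enorm_sub_rpow_le h hp z y).trans (mul_le_mul' ?_ ?_)
      · rw [ENNReal.ofReal_rpow_of_nonneg dist_nonneg (by linarith)]
        exact ENNReal.ofReal_le_ofReal (Real.rpow_le_rpow dist_nonneg hd (by linarith))
      · exact lintegral_mono_set (hX.geodesic_subset_ball (hsub hz) hy)
    refine (ENNReal.rpow_le_rpow h1 (by linarith)).trans ?_
    refine (ENNReal.rpow_add_le_mul_rpow_add_rpow _ _ hp.le).trans ?_
    rw [hQ]
    gcongr
  have h0 : m (Metric.ball x r) ≠ 0 := ((ENNReal.ofReal_pos.2 ha).trans_le hlow).ne'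
  have hint : ‖f y‖ₑ ^ p * m (Metric.ball x r) ≤ ENNReal.ofReal (2 ^ (p - 1)) *
      (J + ENNReal.ofReal ((16 * r) ^ (p - 1)) * I * m (Metric.ball x r)) := by
    rw [← setLIntegral_const]
    refine (setLIntegral_mono' Metric.isOpen_ball.measurableSet hpt).trans ?_
    rw [lintegral_const_mul' _ _ ENNReal.ofReal_ne_top, lintegral_add_right _ measurable_const,
      setLIntegral_const]
    gcongr
    exact lintegral_mono_set hsub
  calc ‖f y‖ₑ ^ p = ‖f y‖ₑ ^ p * m (Metric.ball x r) * (m (Metric.ball x r))⁻¹ := by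
        rw [mul_assoc, ENNReal.mul_inv_cancel h0 hfin, mul_one]
    _ ≤ ENNReal.ofReal (2 ^ (p - 1)) * (J + ENNReal.ofReal ((16 * r) ^ (p - 1)) * I *
          m (Metric.ball x r)) * (m (Metric.ball x r))⁻¹ := mul_le_mul_left hint _
    _ = ENNReal.ofReal (2 ^ (p - 1)) * ((m (Metric.ball x r))⁻¹ * J +
          ENNReal.ofReal ((16 * r) ^ (p - 1)) * I) := by
        rw [mul_assoc, add_mul, mul_assoc _ (m (Metric.ball x r)), ENNReal.mul_inv_cancel h0 hfin,
          mul_one, mul_comm J]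
    _ ≤ _ := by
        rw [ENNReal.ofReal_inv_of_pos ha]
        gcongr

theorem lengthMeasure_biUnion_geodesic_le {x : X} {F : Finset X} {R M : ℝ} (hR : 0 ≤ R)
    (hF : ∀ w ∈ F, dist x w = R) (hM : (F.card : ℝ) ≤ M) :
    lengthMeasure X (⋃ w ∈ F, geodesic x w) ≤ ENNReal.ofReal (M * R) := by
  refine (measure_biUnion_finset_le F _).trans ?_
  rw [Finset.sum_congr rfl fun w hw => by rw [hX.lengthMeasure_geodesic, hF w hw],
    Finset.sum_const, nsmul_eq_mul, ← ENNReal.ofReal_natCast,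
    ← ENNReal.ofReal_mul (Nat.cast_nonneg _)]
  exact ENNReal.ofReal_le_ofReal (mul_le_mul_of_nonneg_right hM hR)

/-- Cutoff functions with energy estimates on a real tree with a measure for which the balls of
radius `r` have measure comparable to `V r`. -/
theorem exists_cutoff_energy_le [ProperSpace X] {m : Measure X} {V : ℝ → ℝ} {c C : ℝ}
    (hc : 0 < c) (hC : 0 < C) (hV : ∀ r, 0 < r → 0 < V r)
    (hlow : ∀ x r, 0 < r → ENNReal.ofReal (c * V r) ≤ m (Metric.ball x r))
    (hup : ∀ x r, 0 < r → m (Metric.ball x (8 * r)) ≤ ENNReal.ofReal (C * V r))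
    {p : ℝ} (hp : 1 < p) (ρ : X) :
    ∃ C₁ C₂ C₃ C₄ : ℝ, 0 < C₁ ∧ 0 < C₂ ∧ 0 < C₃ ∧ 0 < C₄ ∧
      ∀ (x : X) (r : ℝ), 0 < r →
        ∃ φ : X → ℝ,
          φ ∈ energyDomain m ρ p ∧ Continuous φ ∧ HasCompactSupport φ ∧
          (∀ z, 0 ≤ φ z ∧ φ z ≤ 1) ∧
          (∀ z ∈ Metric.ball x r, φ z = 1) ∧
          (∀ z ∉ Metric.ball x (8 * r), φ z = 0) ∧
          energy ρ p φ ≤ ENNReal.ofReal (C₁ / r ^ (p - 1)) ∧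
          capacity m ρ p (Metric.ball x r) (Metric.ball x (8 * r))ᶜ
            ≤ ENNReal.ofReal (C₁ / r ^ (p - 1)) ∧
          C₁ / r ^ (p - 1) ≤ C₂ * (m.real (Metric.ball x r) / (r ^ (p - 1) * V r)) ∧
          ∀ f ∈ energyDomain m ρ p,
            weightedEnergyOn ρ p (Metric.ball x (8 * r)) f φ
              ≤ ENNReal.ofReal C₃ * energyOn ρ p (Metric.ball x (8 * r)) f
                + ENNReal.ofReal (C₄ / (r ^ (p - 1) * V r)) *
                    ∫⁻ z in Metric.ball x (8 * r), ENNReal.ofReal (|f z| ^ p) ∂m := by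
  have hp0 : 0 < p := by linarith
  -- At most `C / c` geodesics of length `7 * r`, with gradient at most `(5 * r)⁻¹` on them. The
  -- other constants multiply `C₁` by those of the lower volume bound and of the Poincaré
  -- inequality.
  set C₁ : ℝ := C / c * 7 * 5 ^ (-p) with hC₁
  have hC₁pos : 0 < C₁ := by positivity
  refine ⟨C₁, C₁ / c, C₁ * 2 ^ (p - 1) * 16 ^ (p - 1), C₁ * 2 ^ (p - 1) / c, hC₁pos,
    by positivity, by positivity, by positivity, fun x r hr => ?_⟩
  have hVr := hV r hr
  have hcV : 0 < c * V r := by positivity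
  have hfin : m (Metric.ball x r) ≠ ∞ := ne_top_of_le_ne_top ENNReal.ofReal_ne_top
    ((measure_mono (Metric.ball_subset_ball (by linarith))).trans (hup x r hr))
  obtain ⟨F, hFc, hF, hFd⟩ := exists_finset_sphere (x := x) (r := r) hcV
    (show 0 < C * V r by positivity) (fun y => hlow y r hr) (hup x r hr)
  rw [mul_div_mul_right _ _ hVr.ne'] at hFc
  obtain ⟨φ, h01, hlip, hone, hzero, hconst⟩ := hX.exists_cutoff x hr F
  have hlac : LocallyAbsCont φ := locallyAbsCont_of_lipschitz (by positivity) hlip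
  have hφ1 : ∀ z ∈ Metric.ball x r, φ z = 1 := fun z hz => hone z fun w _ =>
    (gromovProduct_le x z w).trans (Metric.mem_ball'.1 hz).le
  -- The geodesic `[x, z]` crosses the sphere of radius `7 * r` at `z₀`, within `2 * r` of some `w ∈
  -- F`. Hence `dist z w ≤ dist x z - 5 * r`, and the Gromov product of `z` and `w` is at least `6 *
  -- r`.
  have hφ0 : ∀ z, 7 * r ≤ dist x z → φ z = 0 := by
    intro z hz
    obtain ⟨z₀, hz₀, hd⟩ := hX.exists_mem_geodesic x z (t := 7 * r) (by linarith) hz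
    obtain ⟨w, hw, hzw⟩ := hFd z₀ hd
    refine hzero z w hw ?_
    have := dist_triangle z z₀ w
    rw [mem_geodesic, dist_comm z₀ z] at hz₀
    rw [gromovProduct, hF w hw]
    linarith
  have hsupp : HasCompactSupport φ := by
    refine HasCompactSupport.intro (isCompact_closedBall x (7 * r)) fun z hz => hφ0 z ?_
    rw [Metric.mem_closedBall'] at hz
    exact (lt_of_not_ge hz).le
  set K : Set X := ⋃ w ∈ F, geodesic x w with hK
  have hKm : MeasurableSet K := (isCompact_biUnion_geodesic hX x F).isClosed.measurableSet
  have hKl : lengthMeasure X K ≤ ENNReal.ofReal (C / c * (7 * r)) :=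
    hX.lengthMeasure_biUnion_geodesic_le (by positivity) hF hFc
  have hgrad := hX.isGradient_treeGradient ρ hlac
  -- The global Lipschitz bound is used on `K`, local constancy off `K`.
  have hae : ∀ᵐ z ∂lengthMeasure X, ‖treeGradient ρ φ z‖ₑ ^ p ≤
      K.indicator (fun _ => ENNReal.ofReal ((5 * r) ^ (-p))) z := by
    have h1 := hX.ae_abs_le hgrad (U := univ) (K := (5 * r)⁻¹) (by positivity)
      fun z _ => Eventually.of_forall fun z' => hlip z' z
    have h2 := hX.ae_abs_le hgrad (U := Kᶜ) (K := 0) le_rfl fun z hz => by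
      filter_upwards [hconst z fun w hw hzw => hz (mem_iUnion₂.2 ⟨w, hw, hzw⟩)] with z' hz'
      rw [hz', sub_self, abs_zero, zero_mul]
    filter_upwards [h1, h2] with z h1 h2
    by_cases hz : z ∈ K
    · rw [indicator_of_mem hz, ← ofReal_abs_rpow _ hp0.le, Real.rpow_neg (by positivity),
        ← Real.inv_rpow (by positivity)]
      exact ENNReal.ofReal_le_ofReal (Real.rpow_le_rpow (abs_nonneg _) (h1 (mem_univ z)) hp0.le)
    · rw [indicator_of_notMem hz, ← ofReal_abs_rpow _ hp0.le,
        le_antisymm (h2 hz) (abs_nonneg _), Real.zero_rpow hp0.ne', ENNReal.ofReal_zero]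
  have hscale : ENNReal.ofReal ((5 * r) ^ (-p)) * ENNReal.ofReal (C / c * (7 * r)) =
      ENNReal.ofReal (C₁ / r ^ (p - 1)) := by
    rw [← ENNReal.ofReal_mul (by positivity), Real.mul_rpow (by norm_num) hr.le, hC₁,
      Real.rpow_neg hr.le, Real.rpow_sub_one hr.ne']
    congr 1
    field_simp
  have henergy : energy ρ p φ ≤ ENNReal.ofReal (C₁ / r ^ (p - 1)) := by
    rw [energy, energyOn, Measure.restrict_univ]
    simp_rw [ofReal_abs_rpow _ hp0.le]
    refine (lintegral_mono_ae hae).trans ?_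
    rw [lintegral_indicator_const hKm, ← hscale]
    gcongr
  have hdom : φ ∈ energyDomain m ρ p := by
    refine ⟨?_, hlac, henergy.trans_lt ENNReal.ofReal_lt_top⟩
    have hind : φ = (Metric.ball x (8 * r)).indicator φ := by
      ext z
      by_cases hz : z ∈ Metric.ball x (8 * r)
      · rw [indicator_of_mem hz]
      · rw [indicator_of_notMem hz]
        rw [Metric.mem_ball', not_lt] at hz
        exact hφ0 z (by linarith)
    rw [hind, memLp_indicator_iff_restrict Metric.isOpen_ball.measurableSet]
    have : IsFiniteMeasure (m.restrict (Metric.ball x (8 * r))) :=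
      ⟨by rw [Measure.restrict_apply_univ]; exact (hup x r hr).trans_lt ENNReal.ofReal_lt_top⟩
    refine MemLp.of_bound hlac.1.aestronglyMeasurable 1 (Eventually.of_forall fun z => ?_)
    rw [Real.norm_eq_abs, abs_of_nonneg (h01 z).1]
    exact (h01 z).2
  refine ⟨φ, hdom, hlac.1, hsupp, h01, hφ1, fun z hz => hφ0 z ?_, henergy, ?_, ?_, fun f hf => ?_⟩
  · rw [Metric.mem_ball', not_lt] at hz
    linarith
  · refine le_trans ?_ henergy
    -- Since `φ` already vanishes beyond `7 * r`, the set `{7 * r < dist x z}` is the required open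
    -- neighborhood of the complement of the large ball.
    refine iInf_le_of_le φ (iInf_le_of_le hdom (iInf_le_of_le
      ⟨_, Metric.isOpen_ball, Subset.rfl, hφ1⟩ (iInf_le_of_le
      ⟨{z | 7 * r < dist x z}, isOpen_lt continuous_const (by fun_prop), fun z hz => ?_,
        fun z hz => hφ0 z (le_of_lt hz)⟩ le_rfl)))
    rw [mem_compl_iff, Metric.mem_ball', not_lt] at hz
    exact lt_of_lt_of_le (by linarith) hz
  · have hB : c * V r ≤ m.real (Metric.ball x r) := by
      rw [Measure.real, ← ENNReal.ofReal_le_iff_le_toReal hfin]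
      exact hlow x r hr
    have hrp : 0 < r ^ (p - 1) := by positivity
    rw [div_mul_div_comm, div_le_div_iff₀ hrp (by positivity)]
    have : 0 ≤ C₁ * r ^ (p - 1) := by positivity
    nlinarith [mul_le_mul_of_nonneg_left hB this]
  · have hgf := hX.isGradient_treeGradient ρ hf.2.1
    set I := ∫⁻ z in Metric.ball x (8 * r), ‖treeGradient ρ f z‖ₑ ^ p ∂lengthMeasure X with hI
    set J := ∫⁻ z in Metric.ball x (8 * r), ‖f z‖ₑ ^ p ∂m with hJ
    set T := ENNReal.ofReal (2 ^ (p - 1)) * (ENNReal.ofReal (c * V r)⁻¹ * J +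
      ENNReal.ofReal ((16 * r) ^ (p - 1)) * I) with hT
    have hfT : ∀ y ∈ Metric.ball x (8 * r), ‖f y‖ₑ ^ p ≤ T := fun y hy =>
      hX.enorm_rpow_le_of_mem_ball hgf hp hr hcV (hlow x r hr) hfin hy
    -- The uniform bound `T` for `|f| ^ p` comes out of the integral, leaving the bound for the
    -- energy of `φ`.
    have hbound : weightedEnergyOn ρ p (Metric.ball x (8 * r)) f φ ≤
        T * (ENNReal.ofReal ((5 * r) ^ (-p)) * lengthMeasure X K) := by
      rw [weightedEnergyOn, ← lintegral_indicator_const hKm, ← lintegral_const_mul _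
        (measurable_const.indicator hKm)]
      refine le_trans ?_ (lintegral_mono'
        (Measure.restrict_le_self (s := Metric.ball x (8 * r))) le_rfl)
      refine lintegral_mono_ae ?_
      filter_upwards [ae_restrict_of_ae hae,
        ae_restrict_mem Metric.isOpen_ball.measurableSet] with z h1 h2
      rw [ENNReal.ofReal_mul (by positivity), ofReal_abs_rpow _ hp0.le, ofReal_abs_rpow _ hp0.le]
      exact mul_le_mul' (hfT z h2) h1
    rw [energyOn]
    simp_rw [ofReal_abs_rpow _ hp0.le]
    rw [← hI, ← hJ]
    refine hbound.trans ((mul_le_mul_right (mul_le_mul_right hKl _) _).trans (le_of_eq ?_))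
    have e3 : ENNReal.ofReal (C₁ * 2 ^ (p - 1) * 16 ^ (p - 1)) = ENNReal.ofReal (2 ^ (p - 1)) *
        ENNReal.ofReal ((16 * r) ^ (p - 1)) * ENNReal.ofReal (C₁ / r ^ (p - 1)) := by
      rw [← ENNReal.ofReal_mul (by positivity), ← ENNReal.ofReal_mul (by positivity),
        Real.mul_rpow (by norm_num) hr.le]
      congr 1
      field_simp
    have e4 : ENNReal.ofReal (C₁ * 2 ^ (p - 1) / c / (r ^ (p - 1) * V r)) =
        ENNReal.ofReal (2 ^ (p - 1)) * ENNReal.ofReal (c * V r)⁻¹ *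
          ENNReal.ofReal (C₁ / r ^ (p - 1)) := by
      rw [← ENNReal.ofReal_mul (by positivity), ← ENNReal.ofReal_mul (by positivity)]
      congr 1
      field_simp
    rw [hscale, e3, e4, hT]
    ring

end IsRealTree

end Cutoff

/-! ### The tree is a proper real tree -/

section TreeGeometry

namespace GluingLabels

variable {b : BranchingFunction} (L : GluingLabels b)

/-- The address of the tip number `i` of the `m`-cell of `s`. -/
def tip (s : Address b) (m : ℤ) (i : Fin (b m)) : Address b where
  digit k := if m < k then s k else if k = m then i else L.outer k
  digit_lt k := by
    split_ifs with h1 h2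
    · exact s.digit_lt k
    · exact h2 ▸ i.isLt
    · exact L.outer_lt k
  eventually_zero := by
    filter_upwards [s.eventually_zero, eventually_gt_atTop m] with k h1 h2
    rw [if_pos h2, h1]

theorem tip_of_lt (s : Address b) {m k : ℤ} (i : Fin (b m)) (h : m < k) : L.tip s m i k = s k :=
  if_pos h

theorem tip_self (s : Address b) (m : ℤ) (i : Fin (b m)) : L.tip s m i m = i := by
  simp [tip]

theorem tip_of_gt (s : Address b) {m k : ℤ} (i : Fin (b m)) (h : k < m) :
    L.tip s m i k = L.outer k := by
  simp only [tip]
  rw [if_neg (by omega), if_neg (by omega)]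

/-- The tip of a cell is the outer tip of its branch, then again an outer tip one level below, and
so on. `tipIndex` therefore follows the digits of `s`, and every term of the series vanishes. -/
theorem tipDist_eq_zero {s : Address b} {m : ℤ} (h : ∀ k < m, s k = L.outer k) :
    L.tipDist m (s m) s = 0 := by
  have hi : ∀ j : ℕ, s (m - j) = L.tipIndex m (s m) s j := by
    intro j
    induction j with
    | zero => simp [tipIndex]
    | succ j ih =>
      rw [tipIndex, if_pos ih, h _ (by push_cast; omega)]
      congr 1
      push_cast; ring
  rw [tipDist]
  simp [← hi]

theorem tipDist_inner_eq {s : Address b} {m : ℤ} (h : ∀ k ≤ m, s k = L.outer k) :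
    L.tipDist m (L.inner m) s = (2 : ℝ) ^ m := by
  refine le_antisymm (L.tipDist_le m _ s) ?_
  have h0 := L.tipDist_eq_zero (s := s) (m := m) fun k hk => h k hk.le
  rw [h m le_rfl] at h0
  have := L.le_tipDist_add_tipDist m (L.inner_ne_outer m) s
  linarith

theorem tipDist_tip_self (s : Address b) (m : ℤ) (i : Fin (b m)) :
    L.tipDist m i (L.tip s m i) = 0 := by
  have := L.tipDist_eq_zero (s := L.tip s m i) (m := m) fun k hk => L.tip_of_gt s i hk
  rwa [tip_self] at this

/-- The tip distance depends only on the digits below the first one that differs from the digits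
of the tip. -/
theorem tipDist_eq_of_agree {s t : Address b} (n : ℤ) (j : ℕ)
    (hs : ∀ k < n + j, s k = L.outer k) (h : ∀ k, n < k → k ≤ n + j → t k = s k) :
    L.tipDist (n + j) (s (n + j)) t = L.tipDist n (s n) t := by
  induction j with
  | zero => simp
  | succ j ih =>
    rw [L.tipDist_eq, if_pos (h _ (by push_cast; omega) le_rfl),
      ← hs _ (by push_cast; omega), show n + ((j + 1 : ℕ) : ℤ) - 1 = n + j by push_cast; ring]
    exact ih (fun k hk => hs k (by push_cast; omega)) fun k h1 h2 => h k h1 (by push_cast; omega)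

theorem topLevel_le {s t : Address b} {n : ℤ} (h : ∀ k, n < k → s k = t k) (hne : s ≠ t) :
    topLevel s t ≤ n := by
  by_contra hc
  exact (topLevel_spec hne).1 (h _ (by omega))

theorem le_topLevel {s t : Address b} {n : ℤ} (h : s n ≠ t n) : n ≤ topLevel s t := by
  by_contra hc
  exact h ((topLevel_spec fun e : s = t => h (by rw [e])).2 n (by omega))

/-- The distance to a tip, inside a cell, is the distance of the tree. -/
theorem treeDist_tip {s t : Address b} {m : ℤ} (i : Fin (b m)) (h : ∀ k, m < k → t k = s k) :
    L.treeDist t (L.tip s m i) = L.tipDist m i t := by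
  set τ := L.tip s m i with hτ
  have hout : ∀ k < m, τ k = L.outer k := fun k hk => L.tip_of_gt s i hk
  have hm : τ m = i := L.tip_self s m i
  by_cases hne : t = τ
  · rw [hne, treeDist, if_pos rfl, hτ, L.tipDist_tip_self]
  have hle : topLevel t τ ≤ m :=
    topLevel_le (fun k hk => by rw [h k hk, hτ, L.tip_of_lt s i hk]) hne
  obtain ⟨h1, h2⟩ := topLevel_spec hne
  rw [L.treeDist_of_ne hne]
  set n := topLevel t τ
  obtain ⟨j, hj⟩ := Int.eq_ofNat_of_zero_le (show 0 ≤ m - n by omega)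
  have hmj : m = n + j := by omega
  -- With `n` the first level of difference, the way from `t` to the tip passes through the center
  -- of the `n`-cell; the remaining leg, from this center to the outer tip, has its full length `2 ^
  -- (n - 1)`.
  have e := L.tipDist_eq_of_agree (s := τ) (t := t) n j (fun k hk => hout k (by omega))
    fun k hk _ => h2 k hk
  rw [← hmj, hm, L.tipDist_eq n, if_neg h1] at e
  rw [e, L.tipDist_inner_eq fun k hk => hout k (by omega)]

theorem treeDist_of_digit_ne {s t : Address b} {m : ℤ} (h : ∀ k, m < k → s k = t k)
    (hne : s m ≠ t m) : L.treeDist s t =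
      L.tipDist (m - 1) (L.inner (m - 1)) s + L.tipDist (m - 1) (L.inner (m - 1)) t := by
  have hst : s ≠ t := fun e => hne (e ▸ rfl)
  rw [L.treeDist_of_ne hst, le_antisymm (topLevel_le h hst) (le_topLevel hne)]

/-- Passing through the center of the `m`-cell is optimal for distinct branches; in a common branch
it is a detour. -/
theorem treeDist_le_of_agree {s t : Address b} {m : ℤ} (h : ∀ k, m < k → s k = t k) :
    L.treeDist s t ≤
      L.tipDist (m - 1) (L.inner (m - 1)) s + L.tipDist (m - 1) (L.inner (m - 1)) t := by
  by_cases hm : s m = t m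
  · have hm' : ∀ k, m - 1 < k → s k = t k := fun k hk => by
      rcases (show m ≤ k by omega).eq_or_lt with rfl | hk
      · exact hm
      · exact h k hk
    have h1 := L.treeDist_tip (s := s) (t := s) ⟨L.inner (m - 1), L.inner_lt _⟩ fun k _ => rfl
    have h2 := L.treeDist_tip (s := s) (t := t) (m := m - 1) ⟨L.inner (m - 1), L.inner_lt _⟩
      fun k hk => (hm' k hk).symm
    rw [← h1, ← h2, L.treeDist_comm t]
    exact L.treeDist_triangle _ _ _
  · exact (L.treeDist_of_digit_ne h hm).le

/-- Induction over `j` levels, starting from the diameter bound. Points in distinct branches of the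
`m`-cell are joined through its center. Four points in one branch are left to the induction; for
three in one branch, the center, which is the inner tip of that branch, replaces the fourth.
Otherwise one of the pairings on the right joins distinct branches twice, and its sum is the sum of
all four distances to the center. -/
theorem treeDist_four_point_approx (j : ℕ) : ∀ (m : ℤ) (s t u v : Address b),
    (∀ k, m < k → t k = s k) → (∀ k, m < k → u k = s k) → (∀ k, m < k → v k = s k) →
    L.treeDist s t + L.treeDist u v ≤
      max (L.treeDist s u + L.treeDist t v) (L.treeDist s v + L.treeDist t u) +
        2 * ((2 : ℝ) ^ m * (1 / 2) ^ j) := by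
  induction j with
  | zero =>
    intro m s t u v ht hu hv
    have h1 := L.treeDist_le_of_mem_cylinder (s := s) (t := t) (n := m) ht
    have h2 := L.treeDist_le_of_mem_cylinder (s := u) (t := v) (n := m)
      fun k hk => (hv k hk).trans (hu k hk).symm
    have h3 := le_max_of_le_left (c := L.treeDist s v + L.treeDist t u)
      (add_nonneg (L.treeDist_nonneg s u) (L.treeDist_nonneg t v))
    rw [pow_zero, mul_one]
    linarith
  | succ j ih =>
    intro m s t u v ht hu hv
    have herr : (2 : ℝ) ^ m * (1 / 2) ^ (j + 1) = (2 : ℝ) ^ (m - 1) * (1 / 2) ^ j := by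
      rw [zpow_sub_one₀ (by norm_num), pow_succ]; ring
    rw [herr]
    have hpos : (0 : ℝ) < (2 : ℝ) ^ (m - 1) * (1 / 2) ^ j := by positivity
    set c : Address b → ℝ := fun x => L.tipDist (m - 1) (L.inner (m - 1)) x with hc
    let o : Address b → Address b := fun x => L.tip x (m - 1) ⟨L.inner (m - 1), L.inner_lt _⟩
    -- equality of the digits above `m`
    let A : Address b → Address b → Prop := fun x y => ∀ k, m < k → x k = y k
    have hss : A s s := fun _ _ => rfl
    have mk : ∀ {x y : Address b}, A x s → A y s → A x y :=
      fun hx hy k hk => (hx k hk).trans (hy k hk).symm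
    have hne : ∀ {x y : Address b}, A x s → A y s → x m ≠ y m → L.treeDist x y = c x + c y :=
      fun hx hy h => L.treeDist_of_digit_ne (mk hx hy) h
    have hle : ∀ {x y : Address b}, A x s → A y s → L.treeDist x y ≤ c x + c y :=
      fun hx hy => L.treeDist_le_of_agree (mk hx hy)
    have below : ∀ {x y : Address b}, A x s → A y s → x m = y m → ∀ k, m - 1 < k → x k = y k := by
      intro x y hx hy h k hk
      rcases (show m ≤ k by omega).eq_or_lt with rfl | hk
      · exact h
      · exact mk hx hy k hk
    have ho : ∀ {x y : Address b}, A x s → A y s → y m = x m → L.treeDist y (o x) = c y :=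
      fun hx hy h => L.treeDist_tip _ (below hy hx h)
    -- three points in the same branch
    have three : ∀ {x y z : Address b}, A x s → A y s → A z s → y m = x m → z m = x m →
        L.treeDist x y + c z ≤ max (L.treeDist x z + c y) (c x + L.treeDist y z) +
          2 * ((2 : ℝ) ^ (m - 1) * (1 / 2) ^ j) := by
      intro x y z hx hy hz hyx hzx
      have h := ih (m - 1) x y z (o x) (below hy hx hyx) (below hz hx hzx)
        fun k hk => L.tip_of_lt x _ hk
      rwa [ho hx hz hzx, ho hx hy hyx, ho hx hx rfl] at h
    by_cases hst : t m = s m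
    · by_cases huv : v m = u m
      · by_cases hsu : u m = s m
        · exact ih (m - 1) s t u v (below ht hss hst) (below hu hss hsu)
            (below hv hss (huv.trans hsu))
        · have a1 := hle hss ht
          have a2 := hle hu hv
          have a3 := hne hss hu (Ne.symm hsu)
          have a4 := hne ht hv (by rw [hst, huv]; exact Ne.symm hsu)
          have := le_max_left (L.treeDist s u + L.treeDist t v) (L.treeDist s v + L.treeDist t u)
          linarith
      · by_cases hsu : u m = s m
        · have a1 := three hss ht hu hst hsu
          have hvs : v m ≠ s m := fun e => huv (e.trans hsu.symm)
          rw [hne hu hv (Ne.symm huv), hne ht hv (by rw [hst]; exact Ne.symm hvs),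
            hne hss hv (Ne.symm hvs)]
          rcases le_total (L.treeDist s u + c t) (c s + L.treeDist t u) with h | h
          · rw [max_eq_right h] at a1; rw [max_eq_right (by linarith)]; linarith
          · rw [max_eq_left h] at a1; rw [max_eq_left (by linarith)]; linarith
        · by_cases hsv : v m = s m
          · have a1 := three hss ht hv hst hsv
            rw [hne hu hv (Ne.symm huv), hne ht hu (by rw [hst]; exact Ne.symm hsu),
              hne hss hu (Ne.symm hsu)]
            rcases le_total (L.treeDist s v + c t) (c s + L.treeDist t v) with h | h
            · rw [max_eq_right h] at a1; rw [max_eq_left (by linarith)]; linarith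
            · rw [max_eq_left h] at a1; rw [max_eq_right (by linarith)]; linarith
          · have a1 := hle hss ht
            have a2 := hle hu hv
            have a3 := hne hss hu (Ne.symm hsu)
            have a4 := hne ht hv (by rw [hst]; exact Ne.symm hsv)
            have := le_max_left (L.treeDist s u + L.treeDist t v)
              (L.treeDist s v + L.treeDist t u)
            linarith
    · by_cases huv : v m = u m
      · by_cases hsu : u m = s m
        · have a1 := three hu hv hss huv hsu.symm
          have htu : t m ≠ u m := fun e => hst (e.trans hsu)
          rw [hne hss ht (Ne.symm hst), hne ht hv (by rw [huv]; exact htu), hne ht hu htu]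
          rw [L.treeDist_comm u s, L.treeDist_comm v s] at a1
          rcases le_total (L.treeDist s u + c v) (c u + L.treeDist s v) with h | h
          · rw [max_eq_right h] at a1; rw [max_eq_right (by linarith)]; linarith
          · rw [max_eq_left h] at a1; rw [max_eq_left (by linarith)]; linarith
        · by_cases htu : u m = t m
          · have a1 := three hu hv ht huv htu.symm
            rw [hne hss ht (Ne.symm hst), hne hss hv (by rw [huv]; exact Ne.symm hsu),
              hne hss hu (Ne.symm hsu)]
            rw [L.treeDist_comm u t, L.treeDist_comm v t] at a1
            rcases le_total (L.treeDist t u + c v) (c u + L.treeDist t v) with h | h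
            · rw [max_eq_right h] at a1; rw [max_eq_left (by linarith)]; linarith
            · rw [max_eq_left h] at a1; rw [max_eq_right (by linarith)]; linarith
          · have a1 := hle hss ht
            have a2 := hle hu hv
            have a3 := hne hss hu (Ne.symm hsu)
            have a4 := hne ht hv (by rw [huv]; exact Ne.symm htu)
            have := le_max_left (L.treeDist s u + L.treeDist t v)
              (L.treeDist s v + L.treeDist t u)
            linarith
      · have a1 := hle hss ht
        have a2 := hle hu hv
        by_cases hsu : s m ≠ u m ∧ t m ≠ v m
        · have a3 := hne hss hu hsu.1
          have a4 := hne ht hv hsu.2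
          have := le_max_left (L.treeDist s u + L.treeDist t v)
            (L.treeDist s v + L.treeDist t u)
          linarith
        · have hsv : s m ≠ v m ∧ t m ≠ u m := by
            by_contra hcon
            grind
          have a3 := hne hss hv hsv.1
          have a4 := hne ht hu hsv.2
          have := le_max_right (L.treeDist s u + L.treeDist t v)
            (L.treeDist s v + L.treeDist t u)
          linarith

theorem exists_agree (s t : Address b) : ∃ n, ∀ m ≥ n, ∀ k, m < k → t k = s k := by
  obtain ⟨N, hN⟩ := eventually_atTop.1 (s.eventually_zero.and t.eventually_zero)
  refine ⟨N, fun m hm k hk => ?_⟩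
  obtain ⟨h1, h2⟩ := hN k (by omega)
  rw [h1, h2]

theorem treeDist_four_point (s t u v : Address b) :
    L.treeDist s t + L.treeDist u v ≤
      max (L.treeDist s u + L.treeDist t v) (L.treeDist s v + L.treeDist t u) := by
  obtain ⟨n₁, h1⟩ := exists_agree s t
  obtain ⟨n₂, h2⟩ := exists_agree s u
  obtain ⟨n₃, h3⟩ := exists_agree s v
  set m := max n₁ (max n₂ n₃)
  have key := fun j => L.treeDist_four_point_approx j m s t u v
    (h1 m (le_max_left _ _)) (h2 m ((le_max_left _ _).trans (le_max_right _ _)))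
    (h3 m ((le_max_right _ _).trans (le_max_right _ _)))
  have hlim := (((tendsto_pow_atTop_nhds_zero_of_lt_one (r := (1 / 2 : ℝ)) (by norm_num)
    (by norm_num)).const_mul ((2 : ℝ) ^ m)).const_mul 2).const_add
    (max (L.treeDist s u + L.treeDist t v) (L.treeDist s v + L.treeDist t u))
  simp only [mul_zero, add_zero] at hlim
  exact ge_of_tendsto' hlim key

theorem surjective_proj : Function.Surjective L.proj :=
  SeparationQuotient.surjective_mk (X := L.PreTree)

/-- Cells are compact. -/
theorem isCompact_cell (s : Address b) (n : ℤ) : IsCompact (L.proj '' s.cylinder n) := by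
  -- The cell is a continuous image of a compact product of finite sets: points that share the
  -- digits above `-N` are within `2 ^ (-N)`.
  let F : (∀ k : ℤ, Fin (b k)) → Address b := fun ω =>
    { digit := fun k => if k ≤ n then (ω k : ℕ) else s k
      digit_lt := fun k => by
        split_ifs
        · exact (ω k).isLt
        · exact s.digit_lt k
      eventually_zero := by
        filter_upwards [s.eventually_zero, eventually_gt_atTop n] with k h1 h2
        rw [if_neg (by omega), h1] }
  have hF : Continuous fun ω => L.proj (F ω) := by
    rw [continuous_iff_continuousAt]
    intro ω
    rw [ContinuousAt, Metric.tendsto_nhds]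
    intro ε hε
    obtain ⟨N, hN⟩ := exists_pow_lt_of_lt_one hε (show (1 / 2 : ℝ) < 1 by norm_num)
    have hev : ∀ᶠ ω' : ∀ k : ℤ, Fin (b k) in 𝓝 ω,
        ∀ k ∈ Finset.Ioc (-(N : ℤ)) n, ω' k = ω k := by
      rw [eventually_all_finset]
      intro k _
      exact (continuous_apply k).continuousAt.preimage_mem_nhds
        (IsOpen.mem_nhds (isOpen_discrete {ω k}) (mem_singleton _))
    filter_upwards [hev] with ω' hω'
    rw [L.dist_proj]
    refine (L.treeDist_le_of_mem_cylinder (n := -(N : ℤ)) fun k hk => ?_).trans_lt ?_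
    · change (if k ≤ n then (ω k : ℕ) else s k) = if k ≤ n then (ω' k : ℕ) else s k
      split_ifs with h
      · rw [hω' k (Finset.mem_Ioc.2 ⟨hk, h⟩)]
      · rfl
    · rwa [zpow_neg, zpow_natCast, ← inv_pow, ← one_div]
  convert! isCompact_range hF using 1
  ext z
  constructor
  · rintro ⟨t, ht, rfl⟩
    refine ⟨fun k => ⟨t k, t.digit_lt k⟩, congrArg L.proj (Address.ext (funext fun k => ?_))⟩
    change (if k ≤ n then t k else s k) = t k
    split_ifs with h
    · rfl
    · exact (ht k (by omega)).symm
  · rintro ⟨ω, rfl⟩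
    exact ⟨F ω, fun k hk => if_neg (by omega), rfl⟩

/-- Cells smaller than a Lebesgue number cannot be split by a clopen set. The subcells of a cell
share its center, so this property climbs level by level up to a cell containing both points. -/
theorem preconnectedSpace_tree : PreconnectedSpace L.Tree := by
  rw [preconnectedSpace_iff_clopen]
  intro U hU
  rcases U.eq_empty_or_nonempty with h | ⟨x, hx⟩
  · exact Or.inl h
  refine Or.inr (eq_univ_of_forall fun y => ?_)
  obtain ⟨s, rfl⟩ := L.surjective_proj x
  obtain ⟨t, rfl⟩ := L.surjective_proj y
  obtain ⟨N, hN⟩ := exists_agree s t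
  have hN := hN N le_rfl
  -- small cells do not meet both `U` and its complement
  obtain ⟨δ, hδ, hball⟩ := lebesgue_number_lemma_of_metric
    (c := fun i : Bool => if i then U else Uᶜ) (L.isCompact_cell s N)
    (fun i => by cases i <;> simp [hU.isOpen, hU.isClosed]) (fun z _ => by
      by_cases hz : z ∈ U
      · exact mem_iUnion.2 ⟨true, by simpa using hz⟩
      · exact mem_iUnion.2 ⟨false, by simpa using hz⟩)
  obtain ⟨j, hj⟩ := exists_pow_lt_of_lt_one (show 0 < δ / (2 : ℝ) ^ N by positivity)
    (show (1 / 2 : ℝ) < 1 by norm_num)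
  have hj' : (2 : ℝ) ^ (N - j) < δ := by
    rw [lt_div_iff₀ (by positivity)] at hj
    rw [zpow_sub₀ (by norm_num), zpow_natCast, div_eq_inv_mul, ← inv_pow, ← one_div]
    exact hj
  have key : ∀ i : ℕ, i ≤ j → ∀ u v : Address b, (∀ k, N < k → u k = s k) →
      (∀ k, N - j + i < k → v k = u k) → L.proj u ∈ U → L.proj v ∈ U := by
    intro i
    induction i with
    | zero =>
      intro _ u v hu hv huU
      obtain ⟨a, ha⟩ := hball (L.proj u) ⟨u, hu, rfl⟩
      have hmem : L.proj v ∈ Metric.ball (L.proj u) δ := by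
        rw [Metric.mem_ball', L.dist_proj]
        exact (L.treeDist_le_of_mem_cylinder (n := N - j) fun k hk =>
          hv k (by push_cast; omega)).trans_lt hj'
      cases a with
      | true => simpa using ha hmem
      | false =>
        have := ha (Metric.mem_ball_self hδ)
        simp only [Bool.false_eq_true, if_false] at this
        exact absurd huU this
    | succ i ih =>
      intro hi u v hu hv huU
      let o : Address b → Address b := fun w =>
        L.tip w (N - j + i) ⟨L.inner (N - j + i), L.inner_lt _⟩
      have ho : ∀ w k, N - j + i < k → o w k = w k := fun w k hk => L.tip_of_lt w _ hk
      have hvs : ∀ k, N < k → v k = s k := fun k hk =>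
        (hv k (by push_cast; omega)).trans (hu k hk)
      have h1 := ih (by omega) u (o u) hu (ho u) huU
      -- The inner tips of the two subcells are both the center of the common cell.
      have h2 : L.proj (o u) = L.proj (o v) := by
        rw [← dist_le_zero, L.dist_proj]
        have := L.treeDist_le_of_agree (s := o u) (t := o v) (m := N - j + i + 1) fun k hk => by
          rw [ho u k (by omega), ho v k (by omega), hv k (by push_cast; omega)]
        rw [add_sub_cancel_right] at this
        refine this.trans (le_of_eq ?_)
        have e := fun w => L.tipDist_tip_self w (N - j + i)
          ⟨L.inner (N - j + i), L.inner_lt _⟩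
        simp only at e
        simp only [o, e, add_zero]
      rw [h2] at h1
      exact ih (by omega) (o v) v (fun k hk => (ho v k (by omega)).trans (hvs k hk))
        (fun k hk => (ho v k hk).symm) h1
  exact key j le_rfl s t (fun _ _ => rfl) (fun k hk => hN k (by omega)) hx

theorem isRealTree : IsRealTree L.Tree where
  four_point x y z w := by
    obtain ⟨s, rfl⟩ := L.surjective_proj x
    obtain ⟨t, rfl⟩ := L.surjective_proj y
    obtain ⟨u, rfl⟩ := L.surjective_proj z
    obtain ⟨v, rfl⟩ := L.surjective_proj w
    exact L.treeDist_four_point s t u v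
  preconnected := L.preconnectedSpace_tree

/-- The distance of a point to the inner tips of its cells tends to infinity with the level. -/
theorem exists_le_tipDist_inner (s : Address b) (K : ℤ) :
    ∃ N, ∀ n ≥ N, (2 : ℝ) ^ K ≤ L.tipDist n (L.inner n) s := by
  obtain ⟨N₁, hN₁⟩ := eventually_atTop.1 s.eventually_zero
  set M := max N₁ (K + 1) with hM
  have hM1 : N₁ ≤ M := le_max_left _ _
  have hM2 : K + 1 ≤ M := le_max_right _ _
  have hpow : ∀ n ≥ M, (2 : ℝ) ^ K ≤ (2 : ℝ) ^ (n - 1) := fun n hn =>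
    zpow_le_zpow_right₀ (by norm_num) (by omega)
  -- From level `M` on, `s` has digit `0`, so a tip `i ≠ 0` is reached only through the center, at
  -- cost at least `2 ^ (n - 1)`.
  have step : ∀ n ≥ M, ∀ i, i ≠ 0 → (2 : ℝ) ^ K ≤ L.tipDist n i s := by
    intro n hn i hi
    rw [L.tipDist_eq, if_neg (by rw [hN₁ n (by omega)]; exact hi.symm)]
    have := L.tipDist_nonneg (n - 1) (L.inner (n - 1)) s
    have := hpow n hn
    linarith
  -- Once one outer tip is far from `s`, all later ones are, and an inner tip number `0` is the
  -- outer tip of the preceding cell. If all outer labels from `M` on are `0`, the inner labels are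
  -- not.
  by_cases h : ∃ n ≥ M, L.outer n ≠ 0
  · obtain ⟨n₀, hn₀, ho⟩ := h
    have hout : ∀ j : ℕ, (2 : ℝ) ^ K ≤ L.tipDist (n₀ + j) (L.outer (n₀ + j)) s := by
      intro j
      induction j with
      | zero => simpa using step n₀ hn₀ _ ho
      | succ j ih =>
        by_cases hz : L.outer (n₀ + (j + 1 : ℕ)) = 0
        · rw [L.tipDist_eq, hN₁ _ (by push_cast; omega), if_pos hz.symm,
            show n₀ + ((j + 1 : ℕ) : ℤ) - 1 = n₀ + j by push_cast; ring]
          exact ih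
        · exact step _ (by push_cast; omega) _ hz
    refine ⟨n₀ + 1, fun n hn => ?_⟩
    by_cases hz : L.inner n = 0
    · rw [L.tipDist_eq, hN₁ _ (by omega), if_pos hz.symm]
      obtain ⟨j, hj⟩ := Int.eq_ofNat_of_zero_le (show 0 ≤ n - 1 - n₀ by omega)
      rw [show n - 1 = n₀ + j by omega]
      exact hout j
    · exact step n (by omega) _ hz
  · push Not at h
    refine ⟨M, fun n hn => step n hn _ fun hz => L.inner_ne_outer n ?_⟩
    rw [hz, h n hn]

/-- A point differing from `s` at a high level is reached only through the inner tip of a large cell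
of `s`, which is far away. So every ball lies in a single cell. -/
theorem exists_treeDist_lt_imp_agree (s : Address b) (K : ℤ) :
    ∃ N, ∀ t, L.treeDist s t < (2 : ℝ) ^ K → ∀ k, N < k → t k = s k := by
  obtain ⟨N, hN⟩ := L.exists_le_tipDist_inner s K
  refine ⟨N, fun t ht k hk => ?_⟩
  by_contra hne
  have hst : s ≠ t := fun e => hne (e ▸ rfl)
  have h1 : k ≤ topLevel s t := le_topLevel (Ne.symm hne)
  have h2 := hN (topLevel s t - 1) (by omega)
  have h3 := L.tipDist_nonneg (topLevel s t - 1) (L.inner (topLevel s t - 1)) t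
  rw [L.treeDist_of_ne hst] at ht
  linarith

theorem properSpace_tree : ProperSpace L.Tree := by
  refine ⟨fun x r => ?_⟩
  obtain ⟨s, rfl⟩ := L.surjective_proj x
  obtain ⟨K, hK⟩ := pow_unbounded_of_one_lt r (show (1 : ℝ) < 2 by norm_num)
  obtain ⟨N, hN⟩ := L.exists_treeDist_lt_imp_agree s K
  refine (L.isCompact_cell s N).of_isClosed_subset Metric.isClosed_closedBall fun z hz => ?_
  obtain ⟨t, rfl⟩ := L.surjective_proj z
  refine ⟨t, hN t ?_, rfl⟩
  rw [Metric.mem_closedBall', L.dist_proj] at hz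
  rw [zpow_natCast]
  exact hz.trans_lt hK

end GluingLabels

end TreeGeometry

/-! ### Volume growth of balls -/

section Volume

namespace BranchingFunction

variable (b : BranchingFunction)

theorem exists_bound : ∃ β : ℕ, ∀ k, b k ≤ β := by
  obtain ⟨β, hβ⟩ := b.bddAbove
  exact ⟨β, fun k => hβ ⟨k, rfl⟩⟩

theorem cast_pos (k : ℤ) : (0 : ℝ) < b k :=
  Nat.cast_pos.2 (Nat.pos_of_ne_zero (NeZero.ne (b k)))

theorem vol_two_zpow (n : ℤ) : b.vol ((2 : ℝ) ^ n) =
    if n + 1 ≤ 0 then (∏ k ∈ Finset.Icc (n + 1) 0, (b k : ℝ))⁻¹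
    else ∏ k ∈ Finset.Icc 1 n, (b k : ℝ) := by
  have hlog : Int.log 2 ((2 : ℝ) ^ n) = n := by
    exact_mod_cast Int.log_zpow (R := ℝ) (b := 2) (by norm_num) n
  simp only [vol, hlog, add_sub_cancel_right]

theorem vol_eq_vol_two_zpow (r : ℝ) : b.vol r = b.vol ((2 : ℝ) ^ Int.log 2 r) := by
  rw [vol_two_zpow, vol, add_sub_cancel_right]

theorem vol_two_zpow_pos (n : ℤ) : 0 < b.vol ((2 : ℝ) ^ n) := by
  rw [vol_two_zpow]
  split_ifs
  · exact inv_pos.2 (Finset.prod_pos fun k _ => b.cast_pos k)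
  · exact Finset.prod_pos fun k _ => b.cast_pos k

theorem vol_two_zpow_succ (n : ℤ) :
    b.vol ((2 : ℝ) ^ (n + 1)) = b (n + 1) * b.vol ((2 : ℝ) ^ n) := by
  have hpos := b.cast_pos
  rw [vol_two_zpow, vol_two_zpow]
  by_cases h1 : n + 1 + 1 ≤ 0
  · rw [if_pos h1, if_pos (by omega),
      show Finset.Icc (n + 1) 0 = insert (n + 1) (Finset.Icc (n + 1 + 1) 0) by
        ext k; simp only [Finset.mem_Icc, Finset.mem_insert]; omega,
      Finset.prod_insert (by simp), mul_inv, mul_inv_cancel_left₀ (hpos _).ne']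
  · rw [if_neg h1]
    by_cases h2 : n + 1 ≤ 0
    -- The transition between the two formulas for the volume, at `V 1 = 1`.
    · obtain rfl : n = -1 := by omega
      simp [(hpos 0).ne']
    · rw [if_neg h2, show Finset.Icc 1 (n + 1) = insert (n + 1) (Finset.Icc 1 n) by
        ext k; simp only [Finset.mem_Icc, Finset.mem_insert]; omega,
        Finset.prod_insert (by simp)]

theorem vol_two_zpow_add_le {β : ℕ} (hβ : ∀ k, b k ≤ β) (n : ℤ) (j : ℕ) :
    b.vol ((2 : ℝ) ^ (n + j)) ≤ (β : ℝ) ^ j * b.vol ((2 : ℝ) ^ n) := by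
  induction j with
  | zero => simp
  | succ j ih =>
    rw [show n + ((j + 1 : ℕ) : ℤ) = n + j + 1 by push_cast; ring, vol_two_zpow_succ, pow_succ',
      mul_assoc]
    exact mul_le_mul (Nat.cast_le.2 (hβ _)) ih (b.vol_two_zpow_pos _).le (Nat.cast_nonneg _)

end BranchingFunction

namespace GluingLabels

variable {b : BranchingFunction} (L : GluingLabels b)

/-- A point near a tip of its `m`-cell has the digits of this tip at all large levels. -/
theorem digit_eq_of_tipDist_lt {t : Address b} {N k : ℤ} (hk : N < k) (j : ℕ) :
    ∀ i, L.tipDist (k + j) i t < (2 : ℝ) ^ N → t k = if j = 0 then i else L.outer k := by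
  induction j with
  | zero =>
    intro i h
    rw [if_pos rfl]
    by_contra hne
    simp only [Nat.cast_zero, add_zero] at h
    rw [L.tipDist_eq, if_neg hne] at h
    have h1 := L.tipDist_nonneg (k - 1) (L.inner (k - 1)) t
    have h2 : (2 : ℝ) ^ N ≤ (2 : ℝ) ^ (k - 1) := zpow_le_zpow_right₀ (by norm_num) (by omega)
    linarith
  | succ j ih =>
    intro i h
    rw [if_neg (Nat.succ_ne_zero j)]
    rw [L.tipDist_eq, show k + ((j + 1 : ℕ) : ℤ) - 1 = k + j by push_cast; ring] at h
    split_ifs at h with hi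
    · have := ih _ h
      split_ifs at this with hj
      · subst hj; simpa using this
      · exact this
    · have h1 := L.tipDist_nonneg (k + j) (L.inner (k + j)) t
      have h2 : (2 : ℝ) ^ N ≤ (2 : ℝ) ^ (k + (j : ℤ)) :=
        zpow_le_zpow_right₀ (by norm_num) (by omega)
      linarith

theorem tipDist_lt_of_treeDist_lt {s t : Address b} {R : ℝ} (hne : s ≠ t)
    (h : L.treeDist s t < R) :
    L.tipDist (topLevel s t - 1) (L.inner (topLevel s t - 1)) s < R ∧
      L.tipDist (topLevel s t - 1) (L.inner (topLevel s t - 1)) t < R := by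
  rw [L.treeDist_of_ne hne] at h
  have h1 := L.tipDist_nonneg (topLevel s t - 1) (L.inner (topLevel s t - 1)) s
  have h2 := L.tipDist_nonneg (topLevel s t - 1) (L.inner (topLevel s t - 1)) t
  constructor <;> linarith

/-- At most one level above `N + 1` is the first level of difference for the points near `s`. -/
theorem topLevel_unique {s t t' : Address b} {N : ℤ} (hne : s ≠ t) (hne' : s ≠ t')
    (h : L.treeDist s t < (2 : ℝ) ^ N) (h' : L.treeDist s t' < (2 : ℝ) ^ N)
    (hN : N + 1 < topLevel s t) (hN' : N + 1 < topLevel s t') :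
    topLevel s t = topLevel s t' := by
  wlog hlt : topLevel s t < topLevel s t' generalizing t t'
  · rcases (not_lt.1 hlt).eq_or_lt with e | e
    · exact e.symm
    · exact (this hne' hne h' h hN' hN e).symm
  exfalso
  have a1 := (L.tipDist_lt_of_treeDist_lt hne h).1
  have a2 := (L.tipDist_lt_of_treeDist_lt hne' h').1
  obtain ⟨j, hj⟩ := Int.eq_ofNat_of_zero_le
    (show 0 ≤ topLevel s t' - 1 - (topLevel s t - 1) by omega)
  -- At level `topLevel s t - 1`, nearness to the inner tip of this cell forces the inner digit,
  -- while nearness to a tip of the larger cell forces the outer one.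
  have b1 := L.digit_eq_of_tipDist_lt (t := s) (k := topLevel s t - 1) (N := N) (by omega) 0
    (L.inner (topLevel s t - 1)) (by simpa using a1)
  have b2 := L.digit_eq_of_tipDist_lt (t := s) (k := topLevel s t - 1) (N := N) (by omega) j
    (L.inner (topLevel s t' - 1)) (by
      rwa [show topLevel s t - 1 + (j : ℤ) = topLevel s t' - 1 by omega])
  rw [if_pos rfl] at b1
  rw [if_neg (by omega)] at b2
  exact L.inner_ne_outer _ (b1.symm.trans b2)

/-- Points near `s` with the same first level of difference from `s` and the same digit at this
level belong to the same `N`-cell. -/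
theorem digit_eq_of_topLevel_eq {s t t' : Address b} {N : ℤ} (hne : s ≠ t) (hne' : s ≠ t')
    (h : L.treeDist s t < (2 : ℝ) ^ N) (h' : L.treeDist s t' < (2 : ℝ) ^ N)
    (htop : topLevel s t = topLevel s t') (hdig : t (topLevel s t) = t' (topLevel s t)) {k : ℤ}
    (hk : N < k) : t k = t' k := by
  rcases lt_trichotomy k (topLevel s t) with hlt | rfl | hgt
  · have a1 := (L.tipDist_lt_of_treeDist_lt hne h).2
    have a2 := (L.tipDist_lt_of_treeDist_lt hne' h').2
    obtain ⟨j, hj⟩ := Int.eq_ofNat_of_zero_le (show 0 ≤ topLevel s t - 1 - k by omega)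
    rw [← htop] at a2
    rw [show topLevel s t - 1 = k + (j : ℤ) by omega] at a1 a2
    rw [L.digit_eq_of_tipDist_lt hk j _ a1, L.digit_eq_of_tipDist_lt hk j _ a2]
  · exact hdig
  · rw [← (topLevel_spec hne).2 k hgt, (topLevel_spec hne').2 k (htop ▸ hgt)]

/-- A ball of radius `2 ^ N` is covered by boundedly many `N`-cells. -/
theorem measure_treeDist_lt_le {β : ℕ} (hβ : ∀ k, b k ≤ β) (s : Address b) (N : ℤ) :
    Address.measure b {t | L.treeDist s t < (2 : ℝ) ^ N} ≤
      ENNReal.ofReal ((1 + 2 * β) * b.vol ((2 : ℝ) ^ N)) := by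
  -- Outside the cell of `s`, the first level of difference is `N + 1` or one further level, unique
  -- by `topLevel_unique`; the Boolean tells which. Together with the digit there it determines the
  -- `N`-cell, whence at most `1 + 2 * β` cells.
  let A : Bool × Fin β → Set (Address b) := fun a =>
    {t | s ≠ t ∧ L.treeDist s t < (2 : ℝ) ^ N ∧ N < topLevel s t ∧
      decide (topLevel s t = N + 1) = a.1 ∧ t (topLevel s t) = a.2}
  have hsub : {t | L.treeDist s t < (2 : ℝ) ^ N} ⊆ s.cylinder N ∪ ⋃ a, A a := by
    intro t ht
    by_cases hcyl : t ∈ s.cylinder N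
    · exact Or.inl hcyl
    · refine Or.inr (mem_iUnion.2 ⟨(decide (topLevel s t = N + 1), ⟨t (topLevel s t),
        (t.digit_lt _).trans_le (hβ _)⟩), ?_, ht, ?_, rfl, rfl⟩)
      · rintro rfl
        exact hcyl fun _ _ => rfl
      · by_contra hc
        refine hcyl fun k hk => ?_
        by_contra hne
        exact hc (hk.trans_le (le_topLevel (Ne.symm hne)))
  have hA : ∀ a, Address.measure b (A a) ≤ ENNReal.ofReal (b.vol ((2 : ℝ) ^ N)) := by
    intro a
    rcases (A a).eq_empty_or_nonempty with h | ⟨t, h1, h2, h3, h4, h5⟩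
    · rw [h, measure_empty]; exact zero_le
    rw [← Address.measure_cylinder t N]
    refine measure_mono ?_
    rintro t' ⟨h1', h2', h3', h4', h5'⟩ k hk
    have htop : topLevel s t = topLevel s t' := by
      by_cases h : topLevel s t = N + 1
      · rw [← h4, decide_eq_true h, decide_eq_true_eq] at h4'
        rw [h, h4']
      · rw [← h4, decide_eq_false h, decide_eq_false_iff_not] at h4'
        exact L.topLevel_unique h1 h1' h2 h2' (by omega) (by omega)
    refine (L.digit_eq_of_topLevel_eq h1 h1' h2 h2' htop ?_ hk).symm
    rw [h5, htop, h5']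
  have hv := (b.vol_two_zpow_pos N).le
  calc Address.measure b {t | L.treeDist s t < (2 : ℝ) ^ N}
      ≤ Address.measure b (s.cylinder N) + ∑ a, Address.measure b (A a) :=
        (measure_mono hsub).trans ((measure_union_le _ _).trans
          (add_le_add le_rfl (measure_iUnion_fintype_le _ _)))
    _ ≤ ENNReal.ofReal (b.vol ((2 : ℝ) ^ N)) +
          ∑ _a : Bool × Fin β, ENNReal.ofReal (b.vol ((2 : ℝ) ^ N)) :=
        add_le_add (Address.measure_cylinder s N).le (Finset.sum_le_sum fun a _ => hA a)
    _ = _ := by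
        rw [Finset.sum_const, Finset.card_univ, Fintype.card_prod, Fintype.card_bool,
          Fintype.card_fin, nsmul_eq_mul, ← ENNReal.ofReal_natCast,
          ← ENNReal.ofReal_mul (Nat.cast_nonneg _),
          ← ENNReal.ofReal_add hv (mul_nonneg (Nat.cast_nonneg _) hv)]
        congr 1
        push_cast
        ring

theorem treeMeasure_ball (s : Address b) (r : ℝ) :
    L.treeMeasure (Metric.ball (L.proj s) r) =
      Address.measure b {t | L.treeDist s t < r} := by
  rw [treeMeasure, Measure.map_apply L.measurable_proj Metric.isOpen_ball.measurableSet]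
  congr 1
  ext t
  rw [mem_preimage, Metric.mem_ball', L.dist_proj]
  rfl

theorem le_treeMeasure_ball {β : ℕ} (hβ : ∀ k, b k ≤ β) (x : L.Tree) {r : ℝ} (hr : 0 < r) :
    ENNReal.ofReal ((β : ℝ)⁻¹ * b.vol r) ≤ L.treeMeasure (Metric.ball x r) := by
  obtain ⟨s, rfl⟩ := L.surjective_proj x
  set n := Int.log 2 r
  have hn : (2 : ℝ) ^ n ≤ r := Int.zpow_log_le_self (b := 2) (by norm_num) hr
  -- Balls are open, so a cell of diameter `2 ^ n ≤ r` need not fit; going down one level costs a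
  -- factor `β`.
  have hn' : (2 : ℝ) ^ (n - 1) < r := (zpow_lt_zpow_right₀ (by norm_num) (by omega)).trans_le hn
  have hβ0 : (0 : ℝ) < β := (b.cast_pos 0).trans_le (Nat.cast_le.2 (hβ 0))
  have hvol := b.vol_two_zpow_add_le hβ (n - 1) 1
  rw [Nat.cast_one, sub_add_cancel, pow_one] at hvol
  rw [treeMeasure_ball, b.vol_eq_vol_two_zpow]
  calc ENNReal.ofReal ((β : ℝ)⁻¹ * b.vol ((2 : ℝ) ^ n))
      ≤ ENNReal.ofReal (b.vol ((2 : ℝ) ^ (n - 1))) := by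
        refine ENNReal.ofReal_le_ofReal ?_
        rwa [inv_mul_le_iff₀ hβ0]
    _ = Address.measure b (s.cylinder (n - 1)) := (Address.measure_cylinder s (n - 1)).symm
    _ ≤ _ := measure_mono fun t ht => (L.treeDist_le_of_mem_cylinder ht).trans_lt hn'

theorem treeMeasure_ball_le {β : ℕ} (hβ : ∀ k, b k ≤ β) (x : L.Tree) (r : ℝ) :
    L.treeMeasure (Metric.ball x (8 * r)) ≤
      ENNReal.ofReal ((1 + 2 * β) * (β : ℝ) ^ 4 * b.vol r) := by
  obtain ⟨s, rfl⟩ := L.surjective_proj x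
  set n := Int.log 2 r
  have hn : r < (2 : ℝ) ^ (n + 1) := Int.lt_zpow_succ_log_self (b := 2) (by norm_num) r
  -- One doubling rounds `r` up and three account for the factor `8`, whence `β ^ 4`.
  have hn' : 8 * r < (2 : ℝ) ^ (n + (4 : ℕ)) := by
    rw [show n + ((4 : ℕ) : ℤ) = 3 + (n + 1) by push_cast; ring, zpow_add₀ (by norm_num)]
    norm_num
    exact hn
  rw [treeMeasure_ball, b.vol_eq_vol_two_zpow]
  refine (measure_mono fun t (ht : L.treeDist s t < 8 * r) => ht.trans hn').trans
    ((L.measure_treeDist_lt_le hβ s (n + (4 : ℕ))).trans (ENNReal.ofReal_le_ofReal ?_))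
  rw [mul_assoc]
  exact mul_le_mul_of_nonneg_left (b.vol_two_zpow_add_le hβ n 4) (by positivity)

end GluingLabels

end Volume

end

theorem proposition3p6 (b : BranchingFunction) (L : GluingLabels b) (p : ℝ) (hp : 1 < p)
    (ρ : L.Tree) :
    ∃ C₁ C₂ C₃ C₄ : ℝ, 0 < C₁ ∧ 0 < C₂ ∧ 0 < C₃ ∧ 0 < C₄ ∧
      ∀ (x : L.Tree) (r : ℝ), 0 < r →
        ∃ φ : L.Tree → ℝ,
          φ ∈ energyDomain L.treeMeasure ρ p ∧ Continuous φ ∧ HasCompactSupport φ ∧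
          (∀ z, 0 ≤ φ z ∧ φ z ≤ 1) ∧
          (∀ z ∈ Metric.ball x r, φ z = 1) ∧
          (∀ z ∉ Metric.ball x (8 * r), φ z = 0) ∧
          energy ρ p φ ≤ ENNReal.ofReal (C₁ / r ^ (p - 1)) ∧
          capacity L.treeMeasure ρ p (Metric.ball x r) (Metric.ball x (8 * r))ᶜ
            ≤ ENNReal.ofReal (C₁ / r ^ (p - 1)) ∧
          C₁ / r ^ (p - 1)
            ≤ C₂ * (L.treeMeasure.real (Metric.ball x r) / (r ^ (p - 1) * b.vol r)) ∧
          ∀ f ∈ energyDomain L.treeMeasure ρ p,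
            weightedEnergyOn ρ p (Metric.ball x (8 * r)) f φ
              ≤ ENNReal.ofReal C₃ * energyOn ρ p (Metric.ball x (8 * r)) f
                + ENNReal.ofReal (C₄ / (r ^ (p - 1) * b.vol r)) *
                    ∫⁻ z in Metric.ball x (8 * r), ENNReal.ofReal (|f z| ^ p) ∂L.treeMeasure := by
  obtain ⟨β, hβ⟩ := b.exists_bound
  have hβ0 : (0 : ℝ) < β := (b.cast_pos 0).trans_le (Nat.cast_le.2 (hβ 0))
  have := L.properSpace_tree
  exact L.isRealTree.exists_cutoff_energy_le (inv_pos.2 hβ0)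
    (C := (1 + 2 * β) * (β : ℝ) ^ 4) (by positivity)
    (fun r _ => b.vol_eq_vol_two_zpow r ▸ b.vol_two_zpow_pos _)
    (fun x r hr => L.le_treeMeasure_ball hβ x hr) (fun x r _ => L.treeMeasure_ball_le hβ x r) hp ρ
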